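/- **Setting.** Let $\mathcal S,\mathcal A$ be finite nonempty sets, $r:\mathcal S\times\mathcal A\times\mathcal S\to\mathbb R$ a reward function, $\bar R=\max_{s,a,s'}|r(s,a,s')|$, $\gamma\in[0,1)$, $\alpha\in(0,1)$, and let $\rho$ be either $\mathrm{VaR}_\alpha$ or $\mathrm{CVaR}_\alpha$, where $$\mathrm{VaR}_\alpha(X)=\inf\{z:\mathbb P(X\le z)\ge\alpha\},\qquad \mathrm{CVaR}_\alpha(X)=\tfrac1\alpha\Big(\mathbb E\big[X\mathbf 1_{\{X\le v\}}\big]+v\,\big(\alpha-\mathbb P(X\le v)\big)\Big),\quad v=\mathrm{VaR}_\alpha(X)$$ (the mean of the lower $\alpha$-tail; the last term vanishes when $\mathbb P(X\le v)=\alpha$). For $Q:\mathcal S\times\mathcal A\to\mathbb R$ and a probability vector $p$ on $\mathcal S$ put $f(p|s,a,Q)=\sum_{s'}p(s')\,[r(s,a,s')+\gamma\max_bQ(s',b)]$. For positive parameter vectors $\phi=(\phi_{s,a})_{s,a}$ define the Bellman operator $$\mathcal T^{\phi}Q(s,a)=\rho_{p\sim\mathrm{Dirichlet}(\phi_{s,a})}\big(f(p|s,a,Q)\big),$$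 and, for i.i.d. samples $p_1,\dots,p_N\sim\mathrm{Dirichlet}(\phi_{s,a})$ and $X_i=f(p_i|s,a,Q)$ with order statistics $X_{1:N}\le\dots\le X_{N:N}$, its estimator $$\widehat{\mathcal T}^{\phi}_NQ(s,a)=X_{\lceil N\alpha\rceil:N}\ \text{ for }\mathrm{VaR}_\alpha,\qquad \widehat{\mathcal T}^{\phi}_NQ(s,a)=\frac1{\lceil N\alpha\rceil}\sum_{j=1}^{\lceil N\alpha\rceil}X_{j:N}\ \text{ for }\mathrm{CVaR}_\alpha.$$ **Data, posterior and sample size.** On a probability space, in stage $t=1,2,\dots$ a batch of $n(t)$ random transitions $(s_{t,i},a_{t,i},s'_{t,i})$, $1\le i\le n(t)$, is observed, with $\sum_tn(t)=\infty$; the observation process is otherwise arbitrary. The prior has parameters $\phi^0_{s,a}(s')\ge1$, and $\phi^t_{s,a}(s')$ is $\phi^0_{s,a}(s')$ plus the number of observations equal to $(s,a,s')$ in stages $1,\dots,t$. The sample sizes start at $N_{s,a}=N\ge1$. The observations are processed one after the other: each observation with $(s_{t,i},a_{t,i})=(s,a)$ replaces $N_{s,a}$ by $\max\{N_{s,a}-1,N\}$,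 and each other observation replaces it by $N_{s,a}+1$. After the batch of stage $t$ has been processed, $m(t)$ iterations are carried out, with $\sum_tm(t)=\infty$. The $k$-th iteration overall belongs to the stage $t_k$ with $\sum_{t=1}^{t_k-1}m(t)<k\le\sum_{t=1}^{t_k}m(t)$. Let $\omega_{t_k}$ denote all observations of stages $1,\dots,t_k$, and $N^{(k)}_{s,a}$ the value of $N_{s,a}$ after stage $t_k$'s batch. In iteration $k$, for each $(s,a)$, samples $p^{(k)}_1,\dots,p^{(k)}_{N^{(k)}_{s,a}}$ are drawn which, conditionally on $\omega_{t_k}$, are i.i.d. with law $\mathrm{Dirichlet}(\phi^{t_k}_{s,a})$, and $\widehat{\mathcal T}^{(k)}Q(s,a)=\widehat{\mathcal T}^{\phi^{t_k}}_{N^{(k)}_{s,a}}Q(s,a)$ is computed from them. **Theorem (diminishing bias of the Bellman estimator).** For all $k\ge 1$, $Q$ and $(s,a)$, the random variables $\widehat{\mathcal T}^{(k)}Q(s,a)$ and $\mathcal T^{\phi^{t_k}}Q(s,a)$ are integrable, and for every $(s,a)$, almost surely, $$\lim_{k\to\infty}\ \sup_{\|Q\|_\infty\le\frac{\bar R}{1-\gamma}}\Big|\mathbb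 E\big[\widehat{\mathcal T}^{(k)}Q(s,a)-\mathcal T^{\phi^{t_k}}Q(s,a)\,\big|\,\omega_{t_k}\big]\Big|=0 .$$ -/

import Mathlib

open MeasureTheory ProbabilityTheory Filter Topology

noncomputable section

namespace BRQL

/-! ### Dirichlet distributions on the probability simplex -/

section Dirichlet

variable {S : Type*} [Fintype S] [DecidableEq S]

/-- The point of the hyperplane `∑ s, p s = 1` whose coordinates other than `s₀` are `q`. -/
def simplexLift (s₀ : S) (q : {s : S // s ≠ s₀} → ℝ) : S → ℝ :=
  fun s => if h : s = s₀ then 1 - ∑ i, q i else q ⟨s, h⟩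

/-- Lebesgue measure on the probability simplex: all coordinates but one are taken as free
coordinates (the measure does not depend on the coordinate left out). -/
def simplexVolume (S : Type*) [Fintype S] [DecidableEq S] [Nonempty S] : Measure (S → ℝ) :=
  ((volume : Measure ({s : S // s ≠ Classical.arbitrary S} → ℝ)).map
    (simplexLift (Classical.arbitrary S))).restrict (stdSimplex ℝ S)

/-- The measure on the simplex with density `∏ s, p s ^ (a s - 1)`, not normalised. -/
def dirichletWeight [Nonempty S] (a : S → ℝ) : Measure (S → ℝ) :=
  (simplexVolume S).withDensity fun p => ENNReal.ofReal (∏ s, p s ^ (a s - 1))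

/-- The Dirichlet distribution with parameter `a`: its density is proportional to
`∏ s, p s ^ (a s - 1)` on the simplex. -/
def dirichlet [Nonempty S] (a : S → ℝ) : Measure (S → ℝ) :=
  (dirichletWeight a Set.univ)⁻¹ • dirichletWeight a

end Dirichlet

/-! ### The risk functionals VaR and CVaR -/

/-- `VaR_α(X) = inf {z | P(X ≤ z) ≥ α}`. -/
def valueAtRisk {E : Type*} [MeasurableSpace E] (α : ℝ) (μ : Measure E) (X : E → ℝ) : ℝ :=
  sInf {z : ℝ | α ≤ μ.real {e | X e ≤ z}}

/-- The mean of the lower `α`-tail distribution of `X`. With `v = VaR_α(X)` it is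
`α⁻¹ (E[X; X ≤ v] + v (α - P(X ≤ v)))`; the second summand accounts for an atom of `X` at `v`. -/
def condValueAtRisk {E : Type*} [MeasurableSpace E] (α : ℝ) (μ : Measure E) (X : E → ℝ) : ℝ :=
  α⁻¹ * ((∫ e in {e | X e ≤ valueAtRisk α μ X}, X e ∂μ) +
    valueAtRisk α μ X * (α - μ.real {e | X e ≤ valueAtRisk α μ X}))

/-- When `P(X ≤ VaR_α(X)) = α`, e.g. when `X` has no atoms, CVaR is `α⁻¹ E[X; X ≤ VaR_α(X)]`. -/
theorem condValueAtRisk_eq {E : Type*} [MeasurableSpace E] (α : ℝ) (μ : Measure E) (X : E → ℝ)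
    (h : μ.real {e | X e ≤ valueAtRisk α μ X} = α) :
    condValueAtRisk α μ X = α⁻¹ * ∫ e in {e | X e ≤ valueAtRisk α μ X}, X e ∂μ := by
  simp [condValueAtRisk, h]

/-- The two risk functionals considered. -/
inductive RiskKind where
  | VaR
  | CVaR

/-- The risk functional `ρ`, at level `α`, of the random variable `X` under `μ`. -/
def risk {E : Type*} [MeasurableSpace E] (ρ : RiskKind) (α : ℝ) (μ : Measure E) (X : E → ℝ) : ℝ :=
  match ρ with
  | .VaR => valueAtRisk α μ X
  | .CVaR => condValueAtRisk α μ X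

/-- The order statistic `X_{k:N}`, the `k`-th smallest of `X₁, …, X_N`, for `1 ≤ k ≤ N`. -/
def orderStat {N : ℕ} (X : Fin N → ℝ) (k : ℕ) : ℝ :=
  if h : 1 ≤ k ∧ k ≤ N then X (Tuple.sort X ⟨k - 1, by omega⟩) else 0

/-- The Monte Carlo estimator of `ρ` at level `α` from the samples `X₁, …, X_N`: the order
statistic `X_{⌈Nα⌉:N}` for VaR, the average of `X_{1:N}, …, X_{⌈Nα⌉:N}` for CVaR. -/
def riskEstimator (ρ : RiskKind) (α : ℝ) {N : ℕ} (X : Fin N → ℝ) : ℝ :=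
  match ρ with
  | .VaR => orderStat X ⌈(N : ℝ) * α⌉₊
  | .CVaR => (⌈(N : ℝ) * α⌉₊ : ℝ)⁻¹ * ∑ k ∈ Finset.Icc 1 ⌈(N : ℝ) * α⌉₊, orderStat X k

/-! ### The Bellman operator and its estimator -/

section MDP

variable {S A : Type*} [Fintype S] [DecidableEq S] [Nonempty S]

/-- `R̄ = max |r(s, a, s')|`. -/
def rewardBound (r : S → A → S → ℝ) : ℝ := ⨆ x : S × A × S, |r x.1 x.2.1 x.2.2|

/-- `f(p | s, a, Q) = ∑ s', p(s') (r(s, a, s') + γ max_b Q(s', b))`. -/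
def expectedValue (r : S → A → S → ℝ) (γ : ℝ) (Q : S → A → ℝ) (s : S) (a : A) (p : S → ℝ) : ℝ :=
  ∑ s', p s' * (r s a s' + γ * ⨆ b, Q s' b)

/-- The Bellman operator `T^φ Q(s, a) = ρ_{p ∼ Dirichlet(φ_{s,a})} (f(p | s, a, Q))`. -/
def bellman (ρ : RiskKind) (α : ℝ) (r : S → A → S → ℝ) (γ : ℝ) (φ : S → A → S → ℝ)
    (Q : S → A → ℝ) (s : S) (a : A) : ℝ :=
  risk ρ α (dirichlet (φ s a)) (expectedValue r γ Q s a)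

/-- The estimator of the Bellman operator from the sampled transition probabilities
`p₁, …, p_N`. -/
def bellmanEstimator (ρ : RiskKind) (α : ℝ) (r : S → A → S → ℝ) (γ : ℝ)
    (Q : S → A → ℝ) (s : S) (a : A) {N : ℕ} (p : Fin N → S → ℝ) : ℝ :=
  riskEstimator ρ α fun i => expectedValue r γ Q s a (p i)

end MDP

/-! ### Posteriors and sample sizes along a stream of observations

A path `x` lists the observed transitions: `x t i`, with `1 ≤ t` and `i < n t`, is the `i`-th
transition `(s, a, s')` of the batch of stage `t`. -/

section Path

variable {S A : Type*} [DecidableEq S] [DecidableEq A]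

/-- The Dirichlet parameter after stage `t`: the prior plus the transition counts. -/
def posterior (φ₀ : S → A → S → ℝ) (n : ℕ → ℕ) (x : ℕ → ℕ → S × A × S) (t : ℕ) :
    S → A → S → ℝ :=
  fun s a s' => φ₀ s a s' +
    ∑ τ ∈ Finset.Icc 1 t, (((Finset.range (n τ)).filter fun i => x τ i = (s, a, s')).card : ℝ)

/-- The sample size for `(s, a)` after the first `i` observations of the batch `b`, starting from
`M`. An observation of `(s, a)` changes the posterior on `(s, a)` and lowers the sample size by
one, but not below `N₀`; any other observation raises it by one. -/
def batchSampleSize (N₀ : ℕ) (s : S) (a : A) (b : ℕ → S × A × S) (M : ℕ) : ℕ → ℕ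
  | 0 => M
  | i + 1 =>
    if (b i).1 = s ∧ (b i).2.1 = a then max (batchSampleSize N₀ s a b M i - 1) N₀
    else batchSampleSize N₀ s a b M i + 1

/-- The sample size `N_{s,a}` used during stage `t`, with initial and minimal value `N₀`. -/
def sampleSize (N₀ : ℕ) (n : ℕ → ℕ) (x : ℕ → ℕ → S × A × S) (s : S) (a : A) : ℕ → ℕ
  | 0 => N₀
  | t + 1 => batchSampleSize N₀ s a (x (t + 1)) (sampleSize N₀ n x s a t) (n (t + 1))

end Path

/-- The stage `t_k` to which the `k`-th iteration belongs, when stage `t` has `m t` iterations. -/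
def stageOf (m : ℕ → ℕ) (k : ℕ) : ℕ := sInf {t | k ≤ ∑ τ ∈ Finset.Icc 1 t, m τ}

/-- `t_k` is the stage with `∑_{t=1}^{t_k-1} m(t) < k ≤ ∑_{t=1}^{t_k} m(t)`. -/
theorem stageOf_spec (m : ℕ → ℕ)
    (hm : Tendsto (fun t => ∑ τ ∈ Finset.Icc 1 t, m τ) atTop atTop) (k : ℕ) (hk : 1 ≤ k) :
    1 ≤ stageOf m k ∧ ∑ τ ∈ Finset.Icc 1 (stageOf m k - 1), m τ < k ∧
      k ≤ ∑ τ ∈ Finset.Icc 1 (stageOf m k), m τ := by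
  have hne : {t | k ≤ ∑ τ ∈ Finset.Icc 1 t, m τ}.Nonempty := (hm.eventually_ge_atTop k).exists
  have h2 : k ≤ ∑ τ ∈ Finset.Icc 1 (stageOf m k), m τ := Nat.sInf_mem hne
  have h1 : 1 ≤ stageOf m k := by
    by_contra h
    have h0 : stageOf m k = 0 := by omega
    simp [h0] at h2
    omega
  refine ⟨h1, ?_, h2⟩
  have := Nat.notMem_of_lt_sInf (s := {t | k ≤ ∑ τ ∈ Finset.Icc 1 t, m τ})
    (m := stageOf m k - 1) (by change _ < stageOf m k; omega)
  simpa using this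

/-! ### The random observations and the Monte Carlo samples -/

section Sampling

variable {Ω S A : Type*} [MeasurableSpace Ω]

/-- The σ-algebra generated by the past observations `ω_t`, those of the stages `1, …, t`. -/
abbrev pastObservations [MeasurableSpace S] [MeasurableSpace A] (n : ℕ → ℕ)
    (obs : ℕ → ℕ → Ω → S × A × S) (t : ℕ) : MeasurableSpace Ω :=
  ⨆ τ ∈ Finset.Icc 1 t, ⨆ i ∈ Finset.range (n τ), MeasurableSpace.comap (obs τ i) inferInstance

/-- The event that the observations of the stages `1, …, t` are those of the path `x`. -/
def pastEvent (n : ℕ → ℕ) (obs : ℕ → ℕ → Ω → S × A × S) (x : ℕ → ℕ → S × A × S) (t : ℕ) : Set Ω :=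
  {ω | ∀ τ ∈ Finset.Icc 1 t, ∀ i ∈ Finset.range (n τ), obs τ i ω = x τ i}

/-- In every iteration `k ≥ 1` and for every `(s, a)`, given the observations up to stage `t_k`,
the sampled transition probabilities `p k s a 0, …, p k s a (N - 1)`, with `N` the current sample
size for `(s, a)`, are independent and have the current Dirichlet posterior on `(s, a)` as their
law. -/
def SampledFromPosterior [Fintype S] [DecidableEq S] [Nonempty S] [DecidableEq A]
    (P : Measure Ω) (φ₀ : S → A → S → ℝ) (N₀ : ℕ) (n m : ℕ → ℕ)
    (obs : ℕ → ℕ → Ω → S × A × S) (p : ℕ → S → A → ℕ → Ω → S → ℝ) : Prop :=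
  ∀ k, 1 ≤ k → ∀ (s : S) (a : A) (x : ℕ → ℕ → S × A × S)
    (B : Set (Fin (sampleSize N₀ n x s a (stageOf m k)) → S → ℝ)), MeasurableSet B →
    P (pastEvent n obs x (stageOf m k) ∩ {ω | (fun i : Fin _ => p k s a i ω) ∈ B}) =
      P (pastEvent n obs x (stageOf m k)) *
        Measure.pi (fun _ => dirichlet (posterior φ₀ n x (stageOf m k) s a)) B

/-- The true value `T^{φ^{t_k}} Q(s, a)` at iteration `k`. -/
def iterBellman [Fintype S] [DecidableEq S] [Nonempty S] [DecidableEq A]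
    (ρ : RiskKind) (α : ℝ) (r : S → A → S → ℝ) (γ : ℝ) (φ₀ : S → A → S → ℝ) (n m : ℕ → ℕ)
    (obs : ℕ → ℕ → Ω → S × A × S) (k : ℕ) (Q : S → A → ℝ) (s : S) (a : A) (ω : Ω) : ℝ :=
  bellman ρ α r γ (posterior φ₀ n (fun t i => obs t i ω) (stageOf m k)) Q s a

/-- The Monte Carlo estimate of `T^{φ^{t_k}} Q(s, a)` at iteration `k`, from the first `N`
samples, `N` being the sample size for `(s, a)` in this iteration. -/
def iterEstimator [Fintype S] [DecidableEq S] [Nonempty S] [DecidableEq A]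
    (ρ : RiskKind) (α : ℝ) (r : S → A → S → ℝ) (γ : ℝ) (N₀ : ℕ) (n m : ℕ → ℕ)
    (obs : ℕ → ℕ → Ω → S × A × S) (p : ℕ → S → A → ℕ → Ω → S → ℝ)
    (k : ℕ) (Q : S → A → ℝ) (s : S) (a : A) (ω : Ω) : ℝ :=
  bellmanEstimator ρ α r γ Q s a
    (fun i : Fin (sampleSize N₀ n (fun t j => obs t j ω) s a (stageOf m k)) => p k s a i ω)

end Sampling

end BRQL

end

namespace BRQL

/-! ### Order statistics -/

section OrderStat

variable {N : ℕ}

/-! Given the observations up to stage `t`, the bias is a deterministic quantity, `dirichletBias`: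
the gap between the mean of the estimator from `N` independent Dirichlet samples and the risk of the
linear functional `weightedMean c`, where `c = stateValues r γ Q s a` is bounded uniformly in `Q`.
The past takes finitely many values, so the conditional expectation is constant on each past event
and, where that event has positive probability, is determined at every point; a supremum over
uncountably many `Q` therefore costs no additional null sets.

Along a fixed path the number of visits to `(s, a)` is nondecreasing, which leaves two cases
(`eventually_dirichletBias_posterior_le`). If it tends to infinity, the Dirichlet posterior
concentrates: each coordinate has variance at most the inverse of the parameter sum, so estimator
and risk are both close to the posterior mean, whatever the sample size (`dirichletBias_le_of_sum`).
If it stays bounded, the posterior is eventually frozen while the sample size tends to infinity, and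
consistency of the empirical quantile applies (`eventually_dirichletBias_le`). Uniformity in `c`
follows from compactness of a cube and the Lipschitz dependence of quantiles on the data.

Both cases use one estimate, `abs_integral_riskEstimator_sub_risk_le`: for VaR and CVaR alike the
bias is bounded by the mean deviation of the empirical quantile plus a rounding error from `⌈Nα⌉`.
For CVaR this compares the sum of the `k` smallest data with `k v - ∑ (v - X i)⁺`.

Two facts about Dirichlet laws are needed. The moments come from integration by parts on the
simplex, which yields recursions for the Dirichlet integral without evaluating it. Uniqueness of the
quantile holds because the simplex is connected and nonempty open parts of it are charged. -/

theorem orderStat_eq (X : Fin N → ℝ) {k : ℕ} (h1 : 1 ≤ k) (h2 : k ≤ N) :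
    orderStat X k = X (Tuple.sort X ⟨k - 1, by omega⟩) := by
  rw [orderStat, dif_pos ⟨h1, h2⟩]

theorem card_filter_sort (X : Fin N → ℝ) (q : ℝ → Prop) [DecidablePred q] :
    (Finset.univ.filter fun j => q (X (Tuple.sort X j))).card =
      (Finset.univ.filter fun i => q (X i)).card :=
  Finset.card_equiv (Tuple.sort X) (by simp)

/-- An order statistic is at most `z` iff enough of the data are. -/
theorem orderStat_le_iff (X : Fin N → ℝ) {k : ℕ} (h1 : 1 ≤ k) (h2 : k ≤ N) (z : ℝ) :
    orderStat X k ≤ z ↔ k ≤ (Finset.univ.filter fun i => X i ≤ z).card := by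
  rw [orderStat_eq X h1 h2, ← card_filter_sort X (· ≤ z)]
  have hmono := Tuple.monotone_sort X
  constructor
  · intro h
    have hsub : Finset.Iic (⟨k - 1, by omega⟩ : Fin N) ⊆
        Finset.univ.filter fun j => X (Tuple.sort X j) ≤ z := by
      intro j hj
      simp only [Finset.mem_filter, Finset.mem_univ, true_and]
      exact (hmono (Finset.mem_Iic.1 hj)).trans h
    have := Finset.card_le_card hsub
    rw [Fin.card_Iic] at this
    simp only at this
    omega
  · intro h
    by_contra hlt
    have hsub : (Finset.univ.filter fun j => X (Tuple.sort X j) ≤ z) ⊆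
        Finset.Iio (⟨k - 1, by omega⟩ : Fin N) := by
      intro j hj
      simp only [Finset.mem_filter, Finset.mem_univ, true_and] at hj
      rw [Finset.mem_Iio]
      by_contra hj'
      exact hlt ((hmono (not_lt.1 hj')).trans hj)
    have := Finset.card_le_card hsub
    rw [Fin.card_Iio] at this
    simp only at this
    omega

/-- Fewer than `k` of the data are below the `k`-th order statistic. -/
theorem card_lt_orderStat_lt (X : Fin N → ℝ) {k : ℕ} (h1 : 1 ≤ k) (h2 : k ≤ N) :
    (Finset.univ.filter fun i => X i < orderStat X k).card < k := by
  rw [← card_filter_sort X (· < orderStat X k), orderStat_eq X h1 h2]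
  have hmono := Tuple.monotone_sort X
  have hsub : (Finset.univ.filter fun j => X (Tuple.sort X j) <
      X (Tuple.sort X ⟨k - 1, by omega⟩)) ⊆ Finset.Iio (⟨k - 1, by omega⟩ : Fin N) := by
    intro j hj
    simp only [Finset.mem_filter, Finset.mem_univ, true_and] at hj
    rw [Finset.mem_Iio]
    by_contra hj'
    exact absurd (hmono (not_lt.1 hj')) (not_le.2 hj)
  have := Finset.card_le_card hsub
  rw [Fin.card_Iio] at this
  simp only at this
  omega

/-- A sublevel set is the event that at least `k` data lie below the level, a condition on a sum of
measurable indicators; the sorting permutation itself is never measured. -/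
theorem measurable_orderStat (k : ℕ) : Measurable fun X : Fin N → ℝ => orderStat X k := by
  by_cases h : 1 ≤ k ∧ k ≤ N
  · refine measurable_of_Iic fun z => ?_
    have : (fun X : Fin N → ℝ => orderStat X k) ⁻¹' Set.Iic z =
        {X | k ≤ ∑ i, if X i ≤ z then 1 else 0} := by
      ext X
      simp only [Set.mem_preimage, Set.mem_Iic, Set.mem_ofPred_eq]
      rw [orderStat_le_iff X h.1 h.2, Finset.card_filter]
    rw [this]
    refine measurableSet_le measurable_const (Finset.measurable_sum _ fun i _ => ?_)
    exact Measurable.ite (measurableSet_le (measurable_pi_apply i) measurable_const)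
      measurable_const measurable_const
  · simp only [orderStat, dif_neg h]
    exact measurable_const

/-- Each of the at least `k` indices with `Y i ≤ orderStat Y k` also satisfies `X i ≤ orderStat Y k
+ δ`. -/
theorem orderStat_le_add {X Y : Fin N → ℝ} {k : ℕ} (h1 : 1 ≤ k) (h2 : k ≤ N) {δ : ℝ}
    (h : ∀ i, X i ≤ Y i + δ) : orderStat X k ≤ orderStat Y k + δ := by
  rw [orderStat_le_iff X h1 h2]
  refine ((orderStat_le_iff Y h1 h2 _).1 le_rfl).trans (Finset.card_le_card fun i hi => ?_)
  simp only [Finset.mem_filter, Finset.mem_univ, true_and] at hi ⊢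
  linarith [h i]

/-- Order statistics are `1`-Lipschitz for the sup norm. -/
theorem abs_orderStat_sub_le {X Y : Fin N → ℝ} {k : ℕ} (h1 : 1 ≤ k) (h2 : k ≤ N) {δ : ℝ}
    (h : ∀ i, |X i - Y i| ≤ δ) : |orderStat X k - orderStat Y k| ≤ δ := by
  have hX := orderStat_le_add h1 h2 fun i => (by linarith [(abs_le.1 (h i)).2] : X i ≤ Y i + δ)
  have hY := orderStat_le_add h1 h2 fun i => (by linarith [(abs_le.1 (h i)).1] : Y i ≤ X i + δ)
  rw [abs_le]
  constructor <;> linarith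

/-- A crude domination, used for integrability; it also covers the default value `0` for `k` out of
range. -/
theorem abs_orderStat_le_sum (X : Fin N → ℝ) (k : ℕ) : |orderStat X k| ≤ ∑ i, |X i| := by
  rw [orderStat]
  split_ifs with h
  · exact Finset.single_le_sum (f := fun i => |X i|) (fun i _ => abs_nonneg _) (Finset.mem_univ _)
  · simpa using Finset.sum_nonneg fun i _ => abs_nonneg (X i)

/-- The distance of an order statistic from `μ` is controlled by the mean distance of the data. -/
theorem mul_abs_orderStat_sub_le (X : Fin N → ℝ) {k : ℕ} (h1 : 1 ≤ k) (h2 : k ≤ N) (μ : ℝ)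
    {d : ℝ} (hd1 : d ≤ k) (hd2 : d ≤ N - k + 1) :
    d * |orderStat X k - μ| ≤ ∑ i, |X i - μ| := by
  set w := orderStat X k with hw
  rcases le_total w μ with h | h
  · rw [abs_of_nonpos (by linarith)]
    -- At least `k` data lie at or below `w`, each at distance at least `μ - w` from `μ`.
    have hk := (orderStat_le_iff X h1 h2 w).1 le_rfl
    calc d * -(w - μ) ≤ ((Finset.univ.filter fun i => X i ≤ w).card : ℝ) * (μ - w) := by
          rw [neg_sub]
          exact mul_le_mul_of_nonneg_right (hd1.trans (by exact_mod_cast hk)) (by linarith)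
      _ = ∑ i ∈ Finset.univ.filter fun i => X i ≤ w, (μ - w) := by rw [Finset.sum_const, nsmul_eq_mul]
      _ ≤ ∑ i ∈ Finset.univ.filter fun i => X i ≤ w, |X i - μ| := by
          refine Finset.sum_le_sum fun i hi => ?_
          simp only [Finset.mem_filter, Finset.mem_univ, true_and] at hi
          rw [abs_sub_comm]
          exact le_trans (by linarith) (le_abs_self _)
      _ ≤ ∑ i, |X i - μ| := Finset.sum_le_sum_of_subset_of_nonneg (Finset.subset_univ _)
          fun i _ _ => abs_nonneg _
  · rw [abs_of_nonneg (by linarith)]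
    -- Symmetrically, at least `N - k + 1` data lie at or above `w`.
    have hk := card_lt_orderStat_lt X h1 h2
    have hcard := Finset.card_filter_add_card_filter_not (s := Finset.univ) (fun i => X i < w)
    rw [Finset.card_univ, Fintype.card_fin] at hcard
    have hge : N + 1 ≤ k + (Finset.univ.filter fun i => ¬ X i < w).card := by
      rw [← hw] at hk; omega
    have hge' : ((N : ℝ) - k + 1) ≤ ((Finset.univ.filter fun i => ¬ X i < w).card : ℝ) := by
      have : (N : ℝ) + 1 ≤ k + ((Finset.univ.filter fun i => ¬ X i < w).card : ℝ) := by
        exact_mod_cast hge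
      linarith
    calc d * (w - μ) ≤ ((Finset.univ.filter fun i => ¬ X i < w).card : ℝ) * (w - μ) :=
          mul_le_mul_of_nonneg_right (hd2.trans hge') (by linarith)
      _ = ∑ i ∈ Finset.univ.filter fun i => ¬ X i < w, (w - μ) := by rw [Finset.sum_const, nsmul_eq_mul]
      _ ≤ ∑ i ∈ Finset.univ.filter fun i => ¬ X i < w, |X i - μ| := by
          refine Finset.sum_le_sum fun i hi => ?_
          simp only [Finset.mem_filter, Finset.mem_univ, true_and, not_lt] at hi
          exact le_trans (by linarith) (le_abs_self _)
      _ ≤ ∑ i, |X i - μ| := Finset.sum_le_sum_of_subset_of_nonneg (Finset.subset_univ _)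
          fun i _ _ => abs_nonneg _

theorem sum_orderStat_eq (X : Fin N → ℝ) {k : ℕ} (h2 : k ≤ N) :
    ∑ j ∈ Finset.Icc 1 k, orderStat X j =
      ∑ j : Fin N, if (j : ℕ) < k then X (Tuple.sort X j) else 0 := by
  have hS : ∀ K, ∑ j ∈ Finset.Icc 1 K, orderStat X j =
      ∑ j ∈ Finset.range K, orderStat X (j + 1) := by
    intro K
    induction K with
    | zero => simp
    | succ K ih => rw [Finset.sum_Icc_succ_top (by omega), ih, Finset.sum_range_succ]
  rw [hS]
  have hF : ∀ j : Fin N, (if (j : ℕ) < k then X (Tuple.sort X j) else 0) =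
      (fun j : ℕ => if j < k then orderStat X (j + 1) else 0) j := by
    intro j
    simp only
    rw [orderStat_eq X (Nat.le_add_left 1 j) j.2]
    simp
  rw [Finset.sum_congr rfl fun j _ => hF j, Fin.sum_univ_eq_sum_range
    (fun j : ℕ => if j < k then orderStat X (j + 1) else 0), ← Finset.sum_filter]
  congr 1
  ext j
  simp only [Finset.mem_range, Finset.mem_filter]
  omega

/-- The sum of the `k` smallest data, compared with the one truncated at a level `v`. -/
theorem abs_sum_orderStat_sub_le (X : Fin N → ℝ) {k : ℕ} (h1 : 1 ≤ k) (h2 : k ≤ N) (v : ℝ) :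
    |∑ j ∈ Finset.Icc 1 k, orderStat X j - (k * v - ∑ i, max (v - X i) 0)| ≤
      N * |orderStat X k - v| := by
  have hmono := Tuple.monotone_sort X
  have hk : (k : ℝ) * v = ∑ j : Fin N, if (j : ℕ) < k then v else 0 := by
    rw [Fin.sum_univ_eq_sum_range (fun j : ℕ => if j < k then v else 0), ← Finset.sum_filter,
      Finset.sum_const, nsmul_eq_mul]
    congr 2
    have : (Finset.range N).filter (· < k) = Finset.range k := by
      ext j
      simp only [Finset.mem_range, Finset.mem_filter]
      omega
    rw [this, Finset.card_range]
  have hmax : ∑ i, max (v - X i) 0 = ∑ j, max (v - X (Tuple.sort X j)) 0 :=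
    (Equiv.sum_comp (Tuple.sort X) fun i => max (v - X i) 0).symm
  rw [sum_orderStat_eq X h2, hk, hmax, ← Finset.sum_sub_distrib, ← Finset.sum_sub_distrib]
  refine (Finset.abs_sum_le_sum_abs _ _).trans ?_
  rw [show (N : ℝ) * |orderStat X k - v| = ∑ _j : Fin N, |orderStat X k - v| by simp]
  refine Finset.sum_le_sum fun j _ => ?_
  rw [orderStat_eq X h1 h2]
  -- Write `w` for the `k`-th order statistic. For a sorted index `j < k` the summand is `(x_j -
  -- v)⁺` with `x_j ≤ w`; for `j ≥ k` it is `(v - x_j)⁺` with `x_j ≥ w`. Both are at most `|w - v|`.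
  split_ifs with hj
  · have hle : X (Tuple.sort X j) ≤ X (Tuple.sort X ⟨k - 1, by omega⟩) :=
      hmono (show j ≤ ⟨k - 1, by omega⟩ from Fin.mk_le_mk.2 (by omega))
    rcases le_total (X (Tuple.sort X j)) v with h | h
    · rw [max_eq_left (by linarith)]
      simp
    · rw [max_eq_right (by linarith)]
      simp only [sub_zero]
      rw [abs_of_nonneg (by linarith)]
      exact le_trans (by linarith) (le_abs_self _)
  · have hle : X (Tuple.sort X ⟨k - 1, by omega⟩) ≤ X (Tuple.sort X j) :=
      hmono (show ⟨k - 1, by omega⟩ ≤ j from Fin.mk_le_mk.2 (by omega))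
    simp only [zero_sub, sub_neg_eq_add, zero_add]
    rw [abs_of_nonneg (le_max_right _ _), abs_sub_comm]
    exact max_le (le_trans (by linarith) (le_abs_self _)) (abs_nonneg _)

/-- Together with `ceil_mul_le` this keeps the index `⌈Nα⌉` in the range where `orderStat` is not
the default value. -/
theorem one_le_ceil_mul {α : ℝ} (hα0 : 0 < α) (hN : 1 ≤ N) : 1 ≤ ⌈(N : ℝ) * α⌉₊ := by
  rw [Nat.one_le_ceil_iff]
  have : (1 : ℝ) ≤ N := by exact_mod_cast hN
  positivity

theorem ceil_mul_le {α : ℝ} (hα1 : α < 1) : ⌈(N : ℝ) * α⌉₊ ≤ N := by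
  rw [Nat.ceil_le]
  have : (0 : ℝ) ≤ N := N.cast_nonneg
  nlinarith

theorem measurable_riskEstimator (ρ : RiskKind) (α : ℝ) :
    Measurable fun X : Fin N → ℝ => riskEstimator ρ α X := by
  cases ρ
  · exact measurable_orderStat _
  · exact (Finset.measurable_sum _ fun k _ => measurable_orderStat k).const_mul _

theorem abs_riskEstimator_le_sum (ρ : RiskKind) {α : ℝ} (X : Fin N → ℝ) :
    |riskEstimator ρ α X| ≤ ∑ i, |X i| := by
  cases ρ
  · exact abs_orderStat_le_sum X _
  · simp only [riskEstimator]
    rw [abs_mul, abs_inv, Nat.abs_cast]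
    rcases Nat.eq_zero_or_pos ⌈(N : ℝ) * α⌉₊ with h | h
    · rw [h]
      simpa using Finset.sum_nonneg fun i _ => abs_nonneg (X i)
    · rw [inv_mul_le_iff₀ (by exact_mod_cast h)]
      refine (Finset.abs_sum_le_sum_abs _ _).trans ?_
      refine (Finset.sum_le_sum fun k _ => abs_orderStat_le_sum X k).trans ?_
      simp

end OrderStat

/-! ### Value at risk of a bounded random variable -/

section ValueAtRisk

variable {E : Type*} [MeasurableSpace E] {ν : Measure E} [IsProbabilityMeasure ν] {α : ℝ}
  {X Y : E → ℝ} {B : ℝ}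

theorem mem_quantileSet_of_ae_le (hα1 : α < 1) (hX : ∀ᵐ e ∂ν, X e ≤ B) :
    B ∈ {z : ℝ | α ≤ ν.real {e | X e ≤ z}} := by
  have : ν.real {e | X e ≤ B} = 1 := by
    -- `X` need not be measurable here: the set is null measurable because its complement is null.
    rw [measureReal_def, (prob_compl_eq_zero_iff₀ ?_).1] <;> [rfl; exact hX; skip]
    exact (NullMeasurableSet.of_compl (NullMeasurableSet.of_null hX))
  rw [Set.mem_ofPred_eq, this]
  exact hα1.le

omit [IsProbabilityMeasure ν] in
theorem le_of_mem_quantileSet (hα0 : 0 < α) (hX : ∀ᵐ e ∂ν, B ≤ X e) {z : ℝ}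
    (hz : α ≤ ν.real {e | X e ≤ z}) : B ≤ z := by
  by_contra hlt
  have : ν.real {e | X e ≤ z} = 0 := by
    rw [measureReal_def, ENNReal.toReal_eq_zero_iff]
    left
    refine measure_mono_null (fun e he => ?_) hX
    simp only [Set.mem_ofPred_eq, Set.mem_compl_iff] at he ⊢
    intro h
    linarith
  linarith

omit [IsProbabilityMeasure ν] in
theorem bddBelow_quantileSet (hα0 : 0 < α) (hX : ∀ᵐ e ∂ν, |X e| ≤ B) :
    BddBelow {z : ℝ | α ≤ ν.real {e | X e ≤ z}} :=
  ⟨-B, fun _ hz => le_of_mem_quantileSet hα0 (hX.mono fun _ h => (abs_le.1 h).1) hz⟩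

theorem quantileSet_nonempty (hα1 : α < 1) (hX : ∀ᵐ e ∂ν, |X e| ≤ B) :
    {z : ℝ | α ≤ ν.real {e | X e ≤ z}}.Nonempty :=
  ⟨B, mem_quantileSet_of_ae_le hα1 (hX.mono fun _ h => (abs_le.1 h).2)⟩

theorem abs_valueAtRisk_le (hα0 : 0 < α) (hα1 : α < 1) (hX : ∀ᵐ e ∂ν, |X e| ≤ B) :
    |valueAtRisk α ν X| ≤ B := by
  rw [abs_le]
  exact ⟨le_csInf (quantileSet_nonempty hα1 hX) fun z hz =>
      le_of_mem_quantileSet hα0 (hX.mono fun _ h => (abs_le.1 h).1) hz,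
    csInf_le (bddBelow_quantileSet hα0 hX)
      (mem_quantileSet_of_ae_le hα1 (hX.mono fun _ h => (abs_le.1 h).2))⟩

omit [IsProbabilityMeasure ν] in
theorem measureReal_lt_of_lt_valueAtRisk (hα0 : 0 < α) (hX : ∀ᵐ e ∂ν, |X e| ≤ B) {z : ℝ}
    (hz : z < valueAtRisk α ν X) : ν.real {e | X e ≤ z} < α :=
  not_le.1 fun h => not_le.2 hz (csInf_le (bddBelow_quantileSet hα0 hX) h)

/-- Strictly above the infimum some element of the quantile set is available, so right continuity of
the distribution function is not needed. This is why later arguments carry an `ε`. -/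
theorem le_measureReal_of_valueAtRisk_lt (hα1 : α < 1) (hX : ∀ᵐ e ∂ν, |X e| ≤ B) {z : ℝ}
    (hz : valueAtRisk α ν X < z) : α ≤ ν.real {e | X e ≤ z} := by
  obtain ⟨y, hy, hyz⟩ := exists_lt_of_csInf_lt (quantileSet_nonempty hα1 hX) hz
  exact le_trans hy (measureReal_mono fun e (he : X e ≤ y) => he.trans hyz.le)

theorem valueAtRisk_le_add (hα0 : 0 < α) (hα1 : α < 1) (hX : ∀ᵐ e ∂ν, |X e| ≤ B)
    {B' : ℝ} (hY : ∀ᵐ e ∂ν, |Y e| ≤ B') {δ : ℝ} (h : ∀ᵐ e ∂ν, X e ≤ Y e + δ) :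
    valueAtRisk α ν X ≤ valueAtRisk α ν Y + δ := by
  refine le_of_forall_pos_le_add fun ε hε => ?_
  refine csInf_le (bddBelow_quantileSet hα0 hX) ?_
  have hz := le_measureReal_of_valueAtRisk_lt (ν := ν) (X := Y) hα1 hY
    (lt_add_of_pos_right (valueAtRisk α ν Y) hε)
  refine le_trans hz (ENNReal.toReal_mono (measure_ne_top _ _) (measure_mono_ae ?_))
  filter_upwards [h] with e he (hle : Y e ≤ _)
  change X e ≤ _
  linarith

theorem abs_valueAtRisk_sub_le (hα0 : 0 < α) (hα1 : α < 1) (hX : ∀ᵐ e ∂ν, |X e| ≤ B)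
    {B' : ℝ} (hY : ∀ᵐ e ∂ν, |Y e| ≤ B') {δ : ℝ} (h : ∀ᵐ e ∂ν, |X e - Y e| ≤ δ) :
    |valueAtRisk α ν X - valueAtRisk α ν Y| ≤ δ := by
  have h1 := valueAtRisk_le_add hα0 hα1 hX hY (δ := δ)
    (h.mono fun e he => by linarith [(abs_le.1 he).2])
  have h2 := valueAtRisk_le_add hα0 hα1 hY hX (δ := δ)
    (h.mono fun e he => by linarith [(abs_le.1 he).1])
  rw [abs_le]
  constructor <;> linarith

/-- The distance of the value at risk from `μ` is controlled by the mean distance. -/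
theorem mul_abs_valueAtRisk_sub_le (hα0 : 0 < α) (hα1 : α < 1) (hXm : Measurable X)
    (hX : ∀ᵐ e ∂ν, |X e| ≤ B) (μ : ℝ) :
    min α (1 - α) * |valueAtRisk α ν X - μ| ≤ ∫ e, |X e - μ| ∂ν := by
  have hint : Integrable X ν := Integrable.of_bound hXm.aestronglyMeasurable B hX
  have hint' : Integrable (fun e => |X e - μ|) ν := (hint.sub (integrable_const μ)).abs
  have hI : 0 ≤ ∫ e, |X e - μ| ∂ν := integral_nonneg fun e => abs_nonneg _
  set v := valueAtRisk α ν X with hv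
  have hmin0 : 0 < min α (1 - α) := lt_min hα0 (by linarith)
  -- Markov's inequality is applied at `d = |v - μ| - ε`. The event `d ≤ |X - μ|` has probability at
  -- least `α` when `v ≤ μ`, since it contains `X ≤ v + ε`, and more than `1 - α` when `μ ≤ v`,
  -- since it contains `X > v - ε`.
  have markov := fun d : ℝ => mul_meas_ge_le_integral_of_nonneg (μ := ν)
    (ae_of_all ν fun e => abs_nonneg (X e - μ)) hint' d
  rcases le_total v μ with h | h
  · rw [abs_of_nonpos (by linarith)]
    refine le_of_forall_pos_le_add fun ε hε => ?_
    rcases le_or_gt (μ - v) ε with hε' | hε'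
    · have : min α (1 - α) * -(v - μ) ≤ 1 * ε :=
        mul_le_mul (by linarith [min_le_left α (1 - α)]) (by linarith) (by linarith) zero_le_one
      linarith
    · have hz := le_measureReal_of_valueAtRisk_lt (ν := ν) (X := X) hα1 hX
        (show v < v + ε by linarith)
      have hsub : ν.real {e | X e ≤ v + ε} ≤ ν.real {e | μ - v - ε ≤ |X e - μ|} := by
        refine measureReal_mono fun e (he : X e ≤ v + ε) => ?_
        change _ ≤ |X e - μ|
        rw [abs_sub_comm]
        exact le_trans (by linarith) (le_abs_self _)
      have := markov (μ - v - ε)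
      have h3 : (μ - v - ε) * min α (1 - α) ≤
          (μ - v - ε) * ν.real {e | μ - v - ε ≤ |X e - μ|} :=
        mul_le_mul_of_nonneg_left ((min_le_left _ _).trans (hz.trans hsub)) (by linarith)
      nlinarith [min_le_left α (1 - α)]
  · rw [abs_of_nonneg (by linarith)]
    refine le_of_forall_pos_le_add fun ε hε => ?_
    rcases le_or_gt (v - μ) ε with hε' | hε'
    · have : min α (1 - α) * (v - μ) ≤ 1 * ε :=
        mul_le_mul (by linarith [min_le_left α (1 - α)]) (by linarith) (by linarith) zero_le_one
      linarith
    · have hz := measureReal_lt_of_lt_valueAtRisk (ν := ν) (X := X) hα0 hX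
        (show v - ε < v by linarith)
      have hc : ν.real {e | X e ≤ v - ε}ᶜ = 1 - ν.real {e | X e ≤ v - ε} :=
        probReal_compl_eq_one_sub (measurableSet_le hXm measurable_const)
      have hsub : ν.real {e | X e ≤ v - ε}ᶜ ≤ ν.real {e | v - μ - ε ≤ |X e - μ|} := by
        refine measureReal_mono fun e he => ?_
        have he' : ¬ X e ≤ v - ε := he
        change _ ≤ |X e - μ|
        exact le_trans (by linarith) (le_abs_self _)
      have := markov (v - μ - ε)
      have h3 : (v - μ - ε) * min α (1 - α) ≤
          (v - μ - ε) * ν.real {e | v - μ - ε ≤ |X e - μ|} :=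
        mul_le_mul_of_nonneg_left (by linarith [min_le_right α (1 - α)]) (by linarith)
      nlinarith [min_le_left α (1 - α)]


/-- The Rockafellar–Uryasev form: the correction for an atom at `v` is absorbed, and what remains is
the mean of a function of `X`, comparable with an empirical sum. -/
theorem condValueAtRisk_eq_sub (hα0 : 0 < α) (hXm : Measurable X)
    (hX : Integrable X ν) :
    condValueAtRisk α ν X = valueAtRisk α ν X -
      α⁻¹ * ∫ e, max (valueAtRisk α ν X - X e) 0 ∂ν := by
  set v := valueAtRisk α ν X with hv
  have hms : MeasurableSet {e | X e ≤ v} := measurableSet_le hXm measurable_const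
  have h1 : ∫ e, max (v - X e) 0 ∂ν = ∫ e in {e | X e ≤ v}, (v - X e) ∂ν := by
    rw [← integral_indicator hms]
    congr 1
    ext e
    by_cases he : X e ≤ v
    · rw [Set.indicator_of_mem (show e ∈ {e | X e ≤ v} from he), max_eq_left (by linarith)]
    · rw [Set.indicator_of_notMem (show e ∉ {e | X e ≤ v} from he), max_eq_right (by linarith)]
  have h2 : ∫ e in {e | X e ≤ v}, (v - X e) ∂ν =
      ν.real {e | X e ≤ v} * v - ∫ e in {e | X e ≤ v}, X e ∂ν := by
    rw [integral_sub (integrable_const v) hX.integrableOn]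
    simp
  rw [condValueAtRisk, ← hv, h1, h2]
  field_simp
  ring

end ValueAtRisk

/-! ### Bias of the Monte Carlo estimators -/

section Bias

variable {E : Type*} [MeasurableSpace E] {ν : Measure E} [IsProbabilityMeasure ν] {α : ℝ}
  {X Y : E → ℝ} {B : ℝ} {N : ℕ}

/-- The mean distance of the order statistic `X_{⌈Nα⌉:N}` from the value at risk. -/
noncomputable def quantileDeviation (α : ℝ) (ν : Measure E) (X : E → ℝ) (N : ℕ) : ℝ :=
  ∫ p, |orderStat (fun i : Fin N => X (p i)) ⌈(N : ℝ) * α⌉₊ - valueAtRisk α ν X|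
    ∂Measure.pi fun _ : Fin N => ν

theorem integrable_comp_of_abs_le_sum (hXm : Measurable X) (hX : Integrable X ν)
    {f : (Fin N → ℝ) → ℝ} (hf : Measurable f) (hle : ∀ x, |f x| ≤ ∑ i, |x i|) :
    Integrable (fun p : Fin N → E => f fun i => X (p i)) (Measure.pi fun _ => ν) := by
  refine Integrable.mono' (g := fun p : Fin N → E => ∑ i, |X (p i)|) ?_ ?_ ?_
  · exact integrable_finsetSum _ fun i _ => integrable_comp_eval (μ := fun _ : Fin N => ν) hX.abs
  · exact (hf.comp (measurable_pi_lambda _ fun i =>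
      hXm.comp (measurable_pi_apply i))).aestronglyMeasurable
  · exact ae_of_all _ fun p => hle _

theorem integrable_orderStat (hXm : Measurable X) (hX : Integrable X ν) (k : ℕ) :
    Integrable (fun p : Fin N → E => orderStat (fun i => X (p i)) k) (Measure.pi fun _ => ν) :=
  integrable_comp_of_abs_le_sum hXm hX (measurable_orderStat k) fun x => abs_orderStat_le_sum x k

theorem integrable_riskEstimator (hXm : Measurable X) (hX : Integrable X ν) (ρ : RiskKind) :
    Integrable (fun p : Fin N → E => riskEstimator ρ α fun i => X (p i))
      (Measure.pi fun _ => ν) :=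
  integrable_comp_of_abs_le_sum hXm hX (measurable_riskEstimator ρ α)
    fun x => abs_riskEstimator_le_sum ρ x

theorem integrable_quantileDeviation (hXm : Measurable X) (hX : Integrable X ν) (k : ℕ) (v : ℝ) :
    Integrable (fun p : Fin N → E => |orderStat (fun i => X (p i)) k - v|)
      (Measure.pi fun _ => ν) :=
  ((integrable_orderStat hXm hX k).sub (integrable_const v)).abs

omit [IsProbabilityMeasure ν] in
theorem quantileDeviation_nonneg : 0 ≤ quantileDeviation α ν X N :=
  integral_nonneg fun _ => abs_nonneg _

theorem ae_pi_of_ae {q : E → Prop} (h : ∀ᵐ e ∂ν, q e) :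
    ∀ᵐ p ∂Measure.pi (fun _ : Fin N => ν), ∀ i, q (p i) :=
  ae_all_iff.2 fun i => (Measure.tendsto_eval_ae_ae (μ := fun _ : Fin N => ν) (i := i)).eventually h

/-- The order statistic and the value at risk are both `1`-Lipschitz for the sup norm, and each
contributes one `δ`. This transfers estimates from a finite net of functionals to all of them. -/
theorem quantileDeviation_le_add (hα0 : 0 < α) (hα1 : α < 1) (hN : 1 ≤ N)
    (hXm : Measurable X) (hX : ∀ᵐ e ∂ν, |X e| ≤ B) (hYm : Measurable Y)
    (hY : ∀ᵐ e ∂ν, |Y e| ≤ B) {δ : ℝ} (h : ∀ᵐ e ∂ν, |X e - Y e| ≤ δ) :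
    quantileDeviation α ν X N ≤ quantileDeviation α ν Y N + 2 * δ := by
  have hiX : Integrable X ν := Integrable.of_bound hXm.aestronglyMeasurable B hX
  have hiY : Integrable Y ν := Integrable.of_bound hYm.aestronglyMeasurable B hY
  have hc : ∫ _p : Fin N → E, 2 * δ ∂(Measure.pi fun _ => ν) = 2 * δ := by simp
  rw [quantileDeviation, quantileDeviation, ← hc, ← integral_add
    (integrable_quantileDeviation hYm hiY _ _) (integrable_const _)]
  refine integral_mono_ae (integrable_quantileDeviation hXm hiX _ _)
    ((integrable_quantileDeviation hYm hiY _ _).add (integrable_const _)) ?_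
  filter_upwards [ae_pi_of_ae (N := N) h] with p hp
  have h1 := abs_orderStat_sub_le (one_le_ceil_mul hα0 hN) (ceil_mul_le hα1) hp
  have h2 := abs_valueAtRisk_sub_le hα0 hα1 hX hY h
  rw [abs_le] at h1 h2 ⊢
  constructor <;>
  rcases abs_cases (orderStat (fun i => Y (p i)) ⌈(N : ℝ) * α⌉₊ - valueAtRisk α ν Y) with h3 | h3 <;>
  linarith

/-- The empirical and the true quantile are each compared with the centre `μ`. The factor `N` from
summing over the data cancels, so the bound does not depend on the sample size. -/
theorem min_mul_quantileDeviation_le (hα0 : 0 < α) (hα1 : α < 1) (hN : 1 ≤ N)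
    (hXm : Measurable X) (hX : ∀ᵐ e ∂ν, |X e| ≤ B) (μ : ℝ) :
    min α (1 - α) * quantileDeviation α ν X N ≤ 2 * ∫ e, |X e - μ| ∂ν := by
  have hiX : Integrable X ν := Integrable.of_bound hXm.aestronglyMeasurable B hX
  have hN' : (0 : ℝ) < N := by exact_mod_cast hN
  have hα' : 0 < min α (1 - α) := lt_min hα0 (by linarith)
  set k := ⌈(N : ℝ) * α⌉₊ with hk
  have hk1 : (N : ℝ) * α ≤ k := Nat.le_ceil _
  have hk2 : (k : ℝ) < N * α + 1 := Nat.ceil_lt_add_one (by positivity)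
  have hpt : ∀ p : Fin N → E, |orderStat (fun i => X (p i)) k - valueAtRisk α ν X| ≤
      (N * min α (1 - α))⁻¹ * ∑ i, |X (p i) - μ| + |valueAtRisk α ν X - μ| := by
    intro p
    -- This `d` is admissible because `k ≥ N α` and `N - k + 1 > N (1 - α)`.
    have h1 := mul_abs_orderStat_sub_le (fun i => X (p i)) (one_le_ceil_mul hα0 hN)
      (ceil_mul_le hα1) μ (d := N * min α (1 - α))
      ((mul_le_mul_of_nonneg_left (min_le_left _ _) hN'.le).trans hk1)
      (by linarith [mul_le_mul_of_nonneg_left (min_le_right α (1 - α)) hN'.le])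
    rw [← le_inv_mul_iff₀ (by positivity)] at h1
    calc _ ≤ |orderStat (fun i => X (p i)) k - μ| + |μ - valueAtRisk α ν X| :=
          abs_sub_le _ _ _
      _ ≤ _ := by rw [abs_sub_comm μ]; linarith
  have hi1 : ∀ i : Fin N, Integrable (fun p : Fin N → E => |X (p i) - μ|)
      (Measure.pi fun _ => ν) := fun i =>
    integrable_comp_eval (μ := fun _ : Fin N => ν) (f := fun e => |X e - μ|)
      (hiX.sub (integrable_const μ)).abs
  have hsum : ∫ p : Fin N → E, ∑ i, |X (p i) - μ| ∂(Measure.pi fun _ => ν) =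
      N * ∫ e, |X e - μ| ∂ν := by
    rw [integral_finsetSum _ fun i _ => hi1 i]
    rw [Finset.sum_congr rfl fun i _ => integral_comp_eval (μ := fun _ : Fin N => ν) (i := i)
      (f := fun e => |X e - μ|) (hXm.sub_const μ).abs.aestronglyMeasurable]
    simp
  have hmain : quantileDeviation α ν X N ≤
      (N * min α (1 - α))⁻¹ * (N * ∫ e, |X e - μ| ∂ν) + |valueAtRisk α ν X - μ| := by
    rw [← hsum, ← integral_const_mul]
    have hc : ∫ _p : Fin N → E, |valueAtRisk α ν X - μ| ∂(Measure.pi fun _ => ν) =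
      |valueAtRisk α ν X - μ| := by simp
    nth_rw 1 [← hc]
    have hsi := (integrable_finsetSum Finset.univ fun i _ => hi1 i).const_mul
      (N * min α (1 - α))⁻¹
    rw [← integral_add hsi (integrable_const _)]
    exact integral_mono (integrable_quantileDeviation hXm hiX _ _)
      (hsi.add (integrable_const _)) hpt
  have hv := mul_abs_valueAtRisk_sub_le hα0 hα1 hXm hX μ
  calc min α (1 - α) * quantileDeviation α ν X N
      ≤ min α (1 - α) * ((N * min α (1 - α))⁻¹ * (N * ∫ e, |X e - μ| ∂ν) +
        |valueAtRisk α ν X - μ|) := mul_le_mul_of_nonneg_left hmain hα'.le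
    _ = (∫ e, |X e - μ| ∂ν) + min α (1 - α) * |valueAtRisk α ν X - μ| := by
        rw [mul_add]
        congr 1
        field_simp
    _ ≤ _ := by linarith

/-- The bias of the estimator of the risk is controlled by the deviation of the empirical quantile,
up to the rounding of the sample fraction. -/
theorem abs_integral_riskEstimator_sub_risk_le (ρ : RiskKind) (hα0 : 0 < α) (hα1 : α < 1)
    (hN : 1 ≤ N) (hXm : Measurable X) (hX : Integrable X ν) :
    |∫ p, riskEstimator ρ α (fun i : Fin N => X (p i)) ∂(Measure.pi fun _ => ν) - risk ρ α ν X| ≤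
      α⁻¹ * quantileDeviation α ν X N +
        (α⁻¹ - N / ⌈(N : ℝ) * α⌉₊) * ∫ e, |X e - valueAtRisk α ν X| ∂ν := by
  have hN' : (0 : ℝ) < N := by exact_mod_cast hN
  have hk1 : (N : ℝ) * α ≤ ⌈(N : ℝ) * α⌉₊ := Nat.le_ceil _
  have hk0 : (0 : ℝ) < ⌈(N : ℝ) * α⌉₊ := lt_of_lt_of_le (by positivity) hk1
  have hfrac : (N : ℝ) / ⌈(N : ℝ) * α⌉₊ ≤ α⁻¹ := by
    rw [div_le_iff₀ hk0, inv_mul_eq_div, le_div_iff₀ hα0]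
    exact hk1
  have hI : 0 ≤ ∫ e, |X e - valueAtRisk α ν X| ∂ν := integral_nonneg fun e => abs_nonneg _
  have hD : 0 ≤ quantileDeviation α ν X N := quantileDeviation_nonneg
  have hαinv : 1 ≤ α⁻¹ := (one_le_inv₀ hα0).2 hα1.le
  cases ρ
  · have h1 : |∫ p, orderStat (fun i : Fin N => X (p i)) ⌈(N : ℝ) * α⌉₊ ∂(Measure.pi fun _ => ν) -
        valueAtRisk α ν X| ≤ quantileDeviation α ν X N := by
      have hc : ∫ _p : Fin N → E, valueAtRisk α ν X ∂(Measure.pi fun _ => ν) =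
        valueAtRisk α ν X := by simp
      nth_rw 1 [← hc]
      rw [← integral_sub (integrable_orderStat hXm hX _) (integrable_const _)]
      exact abs_integral_le_integral_abs
    simp only [riskEstimator, risk]
    -- For VaR the factor `α⁻¹ ≥ 1` and the nonnegative rounding term are slack.
    refine h1.trans ?_
    have := mul_nonneg (sub_nonneg.2 hfrac) hI
    nlinarith
  · simp only [riskEstimator, risk]
    rw [condValueAtRisk_eq_sub hα0 hXm hX]
    set k := ⌈(N : ℝ) * α⌉₊ with hk
    set v := valueAtRisk α ν X with hv
    set M := ∫ e, max (v - X e) 0 ∂ν with hM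
    have hMi : Integrable (fun e => max (v - X e) 0) ν :=
      ((integrable_const v).sub hX).sup (integrable_const 0)
    have hM0 : 0 ≤ M := integral_nonneg fun e => le_max_right _ _
    have hM1 : M ≤ ∫ e, |X e - v| ∂ν := by
      refine integral_mono hMi (hX.sub (integrable_const v)).abs fun e => ?_
      simp only
      rw [abs_sub_comm]
      exact max_le (le_abs_self _) (abs_nonneg _)
    have hi1 : ∀ i : Fin N, Integrable (fun p : Fin N → E => max (v - X (p i)) 0)
        (Measure.pi fun _ => ν) := fun i =>
      integrable_comp_eval (μ := fun _ : Fin N => ν) (f := fun e => max (v - X e) 0) hMi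
    have hi2 := integrable_finsetSum Finset.univ fun i _ => hi1 i
    have hsum : ∫ p : Fin N → E, ∑ i, max (v - X (p i)) 0 ∂(Measure.pi fun _ => ν) = N * M := by
      rw [integral_finsetSum _ fun i _ => hi1 i]
      rw [Finset.sum_congr rfl fun i _ => integral_comp_eval (μ := fun _ : Fin N => ν) (i := i)
        (f := fun e => max (v - X e) 0)
        ((measurable_const.sub hXm).max measurable_const).aestronglyMeasurable]
      simp [hM]
    have hi3 := integrable_finsetSum (μ := Measure.pi fun _ : Fin N => ν) (Finset.Icc 1 k)
      fun j _ => integrable_orderStat (N := N) hXm hX j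
    have herr : |∫ p : Fin N → E, ∑ j ∈ Finset.Icc 1 k, orderStat (fun i => X (p i)) j
        ∂(Measure.pi fun _ => ν) - (k * v - N * M)| ≤ N * quantileDeviation α ν X N := by
      have hc : ∫ p : Fin N → E, (k * v - ∑ i, max (v - X (p i)) 0) ∂(Measure.pi fun _ => ν) =
          k * v - N * M := by
        rw [integral_sub (integrable_const _) hi2, hsum]
        simp
      have hi4 : Integrable (fun p : Fin N → E => k * v - ∑ i, max (v - X (p i)) 0)
        (Measure.pi fun _ => ν) := (integrable_const _).sub hi2
      rw [← hc, ← integral_sub hi3 hi4, quantileDeviation, ← integral_const_mul]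
      refine abs_integral_le_integral_abs.trans (integral_mono
        (hi3.sub hi4).abs
        ((integrable_quantileDeviation hXm hX _ _).const_mul _) fun p => ?_)
      exact abs_sum_orderStat_sub_le (fun i => X (p i)) (one_le_ceil_mul hα0 hN)
        (ceil_mul_le hα1) v
    rw [integral_const_mul]
    set I := ∫ p : Fin N → E, ∑ j ∈ Finset.Icc 1 k, orderStat (fun i => X (p i)) j
      ∂(Measure.pi fun _ => ν)
    -- The average of the `k` smallest data is centred at `v - (N / k) M`, the true CVaR is `v - α⁻¹
    -- M`; the second summand is the effect of rounding `N α` up to `k`.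
    have heq : (k : ℝ)⁻¹ * I - (v - α⁻¹ * M) =
        (k : ℝ)⁻¹ * (I - (k * v - N * M)) + (α⁻¹ - N / k) * M := by
      field_simp
      ring
    rw [heq]
    refine (abs_add_le _ _).trans (add_le_add ?_ ?_)
    · rw [abs_mul, abs_of_pos (inv_pos.2 hk0)]
      calc (k : ℝ)⁻¹ * |I - (k * v - N * M)| ≤ (k : ℝ)⁻¹ * (N * quantileDeviation α ν X N) :=
            mul_le_mul_of_nonneg_left herr (inv_pos.2 hk0).le
        _ = N / k * quantileDeviation α ν X N := by ring
        _ ≤ _ := mul_le_mul_of_nonneg_right hfrac hD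
    · rw [abs_of_nonneg (mul_nonneg (sub_nonneg.2 hfrac) hM0)]
      exact mul_le_mul_of_nonneg_left hM1 (sub_nonneg.2 hfrac)

/-- The left side is `(k - N α) / (α k)` with `k = ⌈N α⌉`, where `k - N α < 1` and `k ≥ N α`. -/
theorem inv_sub_div_ceil_le (hα0 : 0 < α) (hN : 1 ≤ N) :
    α⁻¹ - N / ⌈(N : ℝ) * α⌉₊ ≤ (α ^ 2)⁻¹ * (N : ℝ)⁻¹ := by
  have hN' : (0 : ℝ) < N := by exact_mod_cast hN
  have hk1 : (N : ℝ) * α ≤ ⌈(N : ℝ) * α⌉₊ := Nat.le_ceil _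
  have hk2 : (⌈(N : ℝ) * α⌉₊ : ℝ) < N * α + 1 := Nat.ceil_lt_add_one (by positivity)
  have hk0 : (0 : ℝ) < ⌈(N : ℝ) * α⌉₊ := lt_of_lt_of_le (by positivity) hk1
  set k : ℝ := (⌈(N : ℝ) * α⌉₊ : ℝ)
  have : α⁻¹ - N / k = (k - N * α) / (α * k) := by field_simp
  rw [this, div_le_iff₀ (by positivity)]
  have : (α ^ 2)⁻¹ * (N : ℝ)⁻¹ * (α * k) = k / (N * α) := by field_simp
  rw [this, le_div_iff₀ (by positivity)]
  nlinarith [mul_pos hN' hα0]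

end Bias

/-! ### Consistency of the empirical quantile -/

section Consistency

variable {E : Type*} [MeasurableSpace E] {ν : Measure E} [IsProbabilityMeasure ν] {α : ℝ}
  {X : E → ℝ} {B : ℝ} {N : ℕ}

/-- Chebyshev's inequality for the number of data that are at most `z`. -/
theorem measureReal_abs_card_sub_le (hXm : Measurable X) (z : ℝ) (hN : 1 ≤ N) {η : ℝ}
    (hη : 0 < η) :
    (Measure.pi fun _ : Fin N => ν).real {p | N * η ≤
      |((Finset.univ.filter fun i => X (p i) ≤ z).card : ℝ) - N * ν.real {e | X e ≤ z}|} ≤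
      (η ^ 2)⁻¹ * (N : ℝ)⁻¹ := by
  have hN' : (0 : ℝ) < N := by exact_mod_cast hN
  have hms : MeasurableSet {e | X e ≤ z} := measurableSet_le hXm measurable_const
  set Y : E → ℝ := Set.indicator {e | X e ≤ z} 1 with hY
  have hYm : Measurable Y := measurable_one.indicator hms
  have hYb : ∀ e, Y e ∈ Set.Icc (0 : ℝ) 1 := fun e => by
    by_cases he : e ∈ {e | X e ≤ z} <;> simp [hY, he]
  have hY2 : MemLp Y 2 ν := MemLp.of_bound hYm.aestronglyMeasurable 1
    (ae_of_all _ fun e => by rw [Real.norm_of_nonneg (hYb e).1]; exact (hYb e).2)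
  have hvarY : Var[Y; ν] ≤ 1 := by
    refine (variance_le_sq_of_bounded (ae_of_all _ hYb) hYm.aemeasurable).trans ?_
    norm_num
  have hcard : ∀ p : Fin N → E, ((Finset.univ.filter fun i => X (p i) ≤ z).card : ℝ) =
      (∑ i, fun p : Fin N → E => Y (p i)) p := by
    intro p
    rw [Finset.sum_apply, Finset.card_filter]
    push_cast
    refine Finset.sum_congr rfl fun i _ => ?_
    simp [hY, Set.indicator_apply]
  have hmean : ∫ p, (∑ i, fun p : Fin N → E => Y (p i)) p ∂(Measure.pi fun _ => ν) =
      N * ν.real {e | X e ≤ z} := by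
    simp only [Finset.sum_apply]
    rw [integral_finsetSum _ fun i _ => integrable_comp_eval (μ := fun _ : Fin N => ν)
      (hY2.integrable one_le_two)]
    rw [Finset.sum_congr rfl fun i _ => integral_comp_eval (μ := fun _ : Fin N => ν) (i := i)
      (f := Y) hYm.aestronglyMeasurable]
    rw [hY, integral_indicator_one hms]
    simp
  have hS2 : MemLp (∑ i, fun p : Fin N → E => Y (p i)) 2 (Measure.pi fun _ => ν) :=
    memLp_finsetSum' _ fun i _ => hY2.comp_measurePreserving
      (measurePreserving_eval (fun _ : Fin N => ν) i)
  have hvar : Var[∑ i, fun p : Fin N → E => Y (p i); Measure.pi fun _ => ν] ≤ N := by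
    rw [variance_sum_pi (μ := fun _ : Fin N => ν) (X := fun _ => Y) fun _ => hY2]
    calc ∑ _i : Fin N, Var[Y; ν] ≤ ∑ _i : Fin N, (1 : ℝ) := Finset.sum_le_sum fun i _ => hvarY
      _ = N := by simp
  have hcheb := meas_ge_le_variance_div_sq hS2 (mul_pos hN' hη)
  rw [hmean] at hcheb
  simp only [hcard]
  refine (ENNReal.toReal_mono ENNReal.ofReal_ne_top hcheb).trans ?_
  rw [ENNReal.toReal_ofReal (by positivity [variance_nonneg (∑ i, fun p : Fin N → E => Y (p i)) (Measure.pi fun _ => ν)])]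
  calc _ ≤ (N : ℝ) / (N * η) ^ 2 := by gcongr
    _ = _ := by field_simp

/-- The empirical quantile converges in mean to the value at risk when there is no other
`α`-quantile. -/
theorem tendsto_quantileDeviation (hα0 : 0 < α) (hα1 : α < 1) (hXm : Measurable X)
    (hX : ∀ᵐ e ∂ν, |X e| ≤ B)
    (hgap : ∀ ε > 0, α < ν.real {e | X e ≤ valueAtRisk α ν X + ε}) :
    Tendsto (quantileDeviation α ν X) atTop (𝓝 0) := by
  have hB : 0 ≤ B := (abs_nonneg _).trans (abs_valueAtRisk_le hα0 hα1 hX)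
  have hiX : Integrable X ν := Integrable.of_bound hXm.aestronglyMeasurable B hX
  set v := valueAtRisk α ν X with hv
  have key : ∀ ε > 0, ∃ C : ℝ, ∀ N : ℕ, 1 ≤ N →
      quantileDeviation α ν X N ≤ ε + C * (N : ℝ)⁻¹ := by
    intro ε hε
    set q₁ := ν.real {e | X e ≤ v + ε} with hq₁
    set q₂ := ν.real {e | X e ≤ v - ε} with hq₂
    -- The strict gap above `v` is the uniqueness hypothesis; the one below `v` is automatic from
    -- the infimum.
    have h1 : 0 < q₁ - α := sub_pos.2 (hgap ε hε)
    have h2 : 0 < α - q₂ := sub_pos.2 (measureReal_lt_of_lt_valueAtRisk hα0 hX (by linarith))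
    refine ⟨2 * B * (((q₁ - α) ^ 2)⁻¹ + ((α - q₂) ^ 2)⁻¹), fun N hN => ?_⟩
    have hN' : (0 : ℝ) < N := by exact_mod_cast hN
    have hk1 := one_le_ceil_mul hα0 hN
    have hk2 := ceil_mul_le (N := N) hα1
    set P := Measure.pi fun _ : Fin N => ν
    -- If the empirical quantile exceeds `v + ε`, fewer than `N α` data are at most `v + ε`, so the
    -- count misses its mean `N q₁` by at least `N (q₁ - α)`. If it is below `v - ε`, at least `N α`
    -- data are at most `v - ε`, which is the event `T₂`. On these events the deviation is bounded
    -- by `2 * B`.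
    set T₁ : Set (Fin N → E) := {p | N * (q₁ - α) ≤
      |((Finset.univ.filter fun i => X (p i) ≤ v + ε).card : ℝ) - N * q₁|} with hT₁
    set T₂ : Set (Fin N → E) := {p | N * (α - q₂) ≤
      |((Finset.univ.filter fun i => X (p i) ≤ v - ε).card : ℝ) - N * q₂|} with hT₂
    have hcm : ∀ z, Measurable fun p : Fin N → E =>
        ((Finset.univ.filter fun i => X (p i) ≤ z).card : ℝ) := by
      intro z
      simp only [Finset.card_filter]
      push_cast
      exact Finset.measurable_sum _ fun i _ => Measurable.ite
        (measurableSet_le (hXm.comp (measurable_pi_apply i)) measurable_const)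
        measurable_const measurable_const
    have hm₁ : MeasurableSet T₁ :=
      measurableSet_le measurable_const ((hcm _).sub_const _).abs
    have hm₂ : MeasurableSet T₂ :=
      measurableSet_le measurable_const ((hcm _).sub_const _).abs
    have hpt : ∀ᵐ p ∂P, |orderStat (fun i => X (p i)) ⌈(N : ℝ) * α⌉₊ - v| ≤
        ε + (T₁.indicator (fun _ => 2 * B) p + T₂.indicator (fun _ => 2 * B) p) := by
      filter_upwards [ae_pi_of_ae (N := N) hX] with p hp
      have hi1 : 0 ≤ T₁.indicator (fun _ => 2 * B) p :=
        Set.indicator_nonneg (fun _ _ => by positivity) p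
      have hi2 : 0 ≤ T₂.indicator (fun _ => 2 * B) p :=
        Set.indicator_nonneg (fun _ _ => by positivity) p
      have hw : |orderStat (fun i => X (p i)) ⌈(N : ℝ) * α⌉₊| ≤ B := by
        rw [orderStat_eq _ hk1 hk2]
        exact hp _
      have hvB : |v| ≤ B := abs_valueAtRisk_le hα0 hα1 hX
      have h2B : |orderStat (fun i => X (p i)) ⌈(N : ℝ) * α⌉₊ - v| ≤ 2 * B :=
        (abs_sub _ _).trans (by linarith)
      by_cases hc1 : p ∈ T₁
      · rw [Set.indicator_of_mem hc1]
        linarith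
      by_cases hc2 : p ∈ T₂
      · rw [Set.indicator_of_mem hc2]
        linarith
      have hle : |orderStat (fun i => X (p i)) ⌈(N : ℝ) * α⌉₊ - v| ≤ ε := by
        simp only [hT₁, hT₂, Set.mem_ofPred_eq, not_le] at hc1 hc2
        rw [abs_lt] at hc1 hc2
        rw [abs_le]
        constructor
        · by_contra hlt
          have hle := (orderStat_le_iff (fun i => X (p i)) hk1 hk2 (v - ε)).1 (by linarith)
          rw [Nat.ceil_le] at hle
          linarith
        · rw [sub_le_iff_le_add', orderStat_le_iff (fun i => X (p i)) hk1 hk2 (v + ε),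
            Nat.ceil_le]
          linarith
      linarith
    have hii₁ : Integrable (T₁.indicator fun _ => 2 * B) P := (integrable_const _).indicator hm₁
    have hii₂ : Integrable (T₂.indicator fun _ => 2 * B) P := (integrable_const _).indicator hm₂
    have hI : quantileDeviation α ν X N ≤ ε + (P.real T₁ * (2 * B) + P.real T₂ * (2 * B)) := by
      refine (integral_mono_ae (integrable_quantileDeviation hXm hiX _ _)
        ((integrable_const ε).add (hii₁.add hii₂)) hpt).trans (le_of_eq ?_)
      have e1 := integral_add (integrable_const (μ := P) ε) (hii₁.add hii₂)
      have e2 := integral_add hii₁ hii₂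
      simp only [Pi.add_apply] at e1 e2 ⊢
      rw [e1, e2, integral_indicator_const _ hm₁, integral_indicator_const _ hm₂]
      simp
    have b1 := measureReal_abs_card_sub_le (ν := ν) hXm (v + ε) hN h1
    have b2 := measureReal_abs_card_sub_le (ν := ν) hXm (v - ε) hN h2
    calc _ ≤ _ := hI
      _ ≤ ε + (((q₁ - α) ^ 2)⁻¹ * (N : ℝ)⁻¹ * (2 * B) + ((α - q₂) ^ 2)⁻¹ * (N : ℝ)⁻¹ * (2 * B)) := by
        gcongr
      _ = _ := by ring
  rw [Metric.tendsto_atTop']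
  intro ε hε
  obtain ⟨C, hC⟩ := key (ε / 2) (by positivity)
  have hlim : Tendsto (fun N : ℕ => C * (N : ℝ)⁻¹) atTop (𝓝 0) := by
    simpa using tendsto_inv_atTop_nhds_zero_nat.const_mul C
  obtain ⟨K, hK⟩ := eventually_atTop.1 (hlim.eventually (gt_mem_nhds (half_pos hε)))
  refine ⟨K, fun N hN => ?_⟩
  rw [Real.dist_eq, sub_zero, abs_of_nonneg quantileDeviation_nonneg]
  have := hC N (by omega)
  linarith [hK N hN.le]

end Consistency

/-! ### The simplex in coordinates -/

section Simplex

variable {S : Type*} [Fintype S] [DecidableEq S] (s₀ : S)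

/-- The open simplex, in the coordinates other than `s₀`. -/
def openSimplex : Set ({s : S // s ≠ s₀} → ℝ) := {q | ∀ s, 0 < simplexLift s₀ q s}

variable {s₀}

@[simp] theorem simplexLift_self (q : {s : S // s ≠ s₀} → ℝ) :
    simplexLift s₀ q s₀ = 1 - ∑ i, q i := by simp [simplexLift]

@[simp] theorem simplexLift_coe (q : {s : S // s ≠ s₀} → ℝ) (i : {s : S // s ≠ s₀}) :
    simplexLift s₀ q i = q i := by simp [simplexLift, i.2]

theorem sum_simplexLift (q : {s : S // s ≠ s₀} → ℝ) : ∑ s, simplexLift s₀ q s = 1 := by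
  rw [Fintype.sum_eq_add_sum_subtype_ne _ s₀]
  simp

theorem continuous_simplexLift : Continuous (simplexLift s₀) := by
  refine continuous_pi fun s => ?_
  unfold simplexLift
  split_ifs <;> fun_prop

theorem measurable_simplexLift : Measurable (simplexLift s₀) :=
  continuous_simplexLift.measurable

theorem simplexLift_mem_stdSimplex {q : {s : S // s ≠ s₀} → ℝ} :
    simplexLift s₀ q ∈ stdSimplex ℝ S ↔ ∀ s, 0 ≤ simplexLift s₀ q s :=
  ⟨fun h => h.1, fun h => ⟨h, sum_simplexLift q⟩⟩

theorem simplexLift_le_one {q : {s : S // s ≠ s₀} → ℝ} (hq : q ∈ openSimplex s₀) (s : S) :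
    simplexLift s₀ q s ≤ 1 :=
  (sum_simplexLift q) ▸ Finset.single_le_sum (f := simplexLift s₀ q) (fun t _ => (hq t).le)
    (Finset.mem_univ s)

theorem isOpen_openSimplex : IsOpen (openSimplex s₀) := by
  have : openSimplex s₀ = ⋂ s, {q | 0 < simplexLift s₀ q s} := by ext; simp [openSimplex]
  rw [this]
  exact isOpen_iInter_of_finite fun s => isOpen_lt continuous_const
    ((continuous_apply s).comp continuous_simplexLift)

theorem measurableSet_openSimplex : MeasurableSet (openSimplex s₀) :=
  isOpen_openSimplex.measurableSet

theorem simplexLift_combo (q q' : {s : S // s ≠ s₀} → ℝ) {x y : ℝ} (h : x + y = 1) (s : S) :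
    simplexLift s₀ (x • q + y • q') s = x * simplexLift s₀ q s + y * simplexLift s₀ q' s := by
  by_cases hs : s = s₀
  · subst hs
    simp only [simplexLift_self, Pi.add_apply, Pi.smul_apply, smul_eq_mul,
      Finset.sum_add_distrib, ← Finset.mul_sum]
    linear_combination -h
  · simp [simplexLift, hs]

theorem convex_openSimplex : Convex ℝ (openSimplex s₀) := by
  intro q hq q' hq' x y hx hy hxy s
  rw [simplexLift_combo q q' hxy]
  rcases hx.eq_or_lt with rfl | hx'
  · have : y = 1 := by linarith
    simpa [this] using hq' s
  · have := mul_pos hx' (hq s)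
    have := mul_nonneg hy (hq' s).le
    linarith

theorem nonempty_openSimplex : (openSimplex s₀).Nonempty := by
  have hne : Nonempty S := ⟨s₀⟩
  have hc : (0 : ℝ) < Fintype.card S := by exact_mod_cast Fintype.card_pos
  refine ⟨fun _ => (Fintype.card S : ℝ)⁻¹, fun s => ?_⟩
  by_cases hs : s = s₀
  · subst hs
    have := Fintype.sum_eq_add_sum_subtype_ne (fun _ : S => (Fintype.card S : ℝ)⁻¹) s
    rw [Finset.sum_const, Finset.card_univ, nsmul_eq_mul, mul_inv_cancel₀ hc.ne'] at this
    rw [simplexLift_self, this]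
    simpa using hc
  · simpa [simplexLift, hs] using hc

theorem openSimplex_subset_Icc : openSimplex s₀ ⊆ Set.Icc 0 1 := by
  intro q hq
  refine ⟨fun i => ?_, fun i => ?_⟩
  · simpa using (hq i).le
  · simpa using simplexLift_le_one hq i

theorem volume_openSimplex_lt_top : volume (openSimplex s₀) < ⊤ :=
  (measure_mono openSimplex_subset_Icc).trans_lt isCompact_Icc.measure_lt_top

instance : IsFiniteMeasure (volume.restrict (openSimplex s₀)) :=
  ⟨by simpa using volume_openSimplex_lt_top⟩

/-- In the free coordinates a face lies in a coordinate hyperplane or, for `s₀`, in the affine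
hyperplane `∑ q = 1`, which is proper because it misses the origin. -/
theorem volume_simplexLift_eq_zero (s : S) :
    volume {q : {s : S // s ≠ s₀} → ℝ | simplexLift s₀ q s = 0} = 0 := by
  by_cases hs : s = s₀
  · subst hs
    let L : ({t : S // t ≠ s} → ℝ) →ₗ[ℝ] ℝ := ∑ i, LinearMap.proj i
    have hL : ∀ q, L q = ∑ i, q i := fun q => by simp [L]
    rcases isEmpty_or_nonempty {t : S // t ≠ s} with he | ⟨⟨i⟩⟩
    · have : {q : {t : S // t ≠ s} → ℝ | simplexLift s q s = 0} = ∅ := by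
        ext q
        simp
      rw [this, measure_empty]
    · let A : AffineSubspace ℝ ({t : S // t ≠ s} → ℝ) :=
        (AffineSubspace.mk' (1 : ℝ) ⊥).comap L.toAffineMap
      have hA : ∀ q, q ∈ A ↔ ∑ j, q j = 1 := fun q => by
        simp [A, AffineSubspace.mem_comap, AffineSubspace.mem_mk', hL, sub_eq_zero]
      have hne : A ≠ ⊤ := by
        intro h
        have h0 : (0 : {t : S // t ≠ s} → ℝ) ∈ A := by rw [h]; trivial
        rw [hA] at h0
        simp at h0
      have hAset : {q : {t : S // t ≠ s} → ℝ | simplexLift s q s = 0} = (A : Set _) := by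
        ext q
        simp only [Set.mem_ofPred_eq, simplexLift_self, SetLike.mem_coe, hA]
        constructor <;> intro h <;> linarith
      rw [hAset]
      exact Measure.addHaar_affineSubspace _ A hne
  · have : {q : {t : S // t ≠ s₀} → ℝ | simplexLift s₀ q s = 0} =
        {q | q ⟨s, hs⟩ = 0} := by
      ext q
      simp [simplexLift, hs]
    rw [this]
    exact Measure.pi_hyperplane (fun _ : {t : S // t ≠ s₀} => (volume : Measure ℝ)) ⟨s, hs⟩ 0

/-- The faces are null, so one may work on the open simplex, where all coordinates are positive and
real powers obey the usual rules. -/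
theorem preimage_stdSimplex_ae_eq :
    (simplexLift s₀ ⁻¹' stdSimplex ℝ S : Set _) =ᵐ[volume] openSimplex s₀ := by
  have hae : ∀ᵐ q : {s : S // s ≠ s₀} → ℝ, ∀ s, simplexLift s₀ q s ≠ 0 :=
    ae_all_iff.2 fun s => by
      rw [ae_iff]
      simpa using volume_simplexLift_eq_zero s
  filter_upwards [hae] with q hq
  refine propext ?_
  change simplexLift s₀ q ∈ stdSimplex ℝ S ↔ q ∈ openSimplex s₀
  rw [simplexLift_mem_stdSimplex]
  exact forall_congr' fun s => ⟨fun h => h.lt_of_ne (hq s).symm, fun h => h.le⟩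

theorem simplexVolume_eq_map (S : Type*) [Fintype S] [DecidableEq S] [Nonempty S] :
    simplexVolume S = (volume.restrict (openSimplex (Classical.arbitrary S))).map
      (simplexLift (Classical.arbitrary S)) := by
  rw [simplexVolume, Measure.restrict_map measurable_simplexLift
    (isClosed_stdSimplex ℝ S).measurableSet, Measure.restrict_congr_set preimage_stdSimplex_ae_eq]

end Simplex

/-! ### Dirichlet integrals -/

section DirichletIntegral

variable {S : Type*} [Fintype S] [DecidableEq S] (s₀ : S)

/-- The Dirichlet integral `∫ ∏ s, p s ^ (a s - 1)` over the simplex. -/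
noncomputable def dirichletIntegral (a : S → ℝ) : ℝ :=
  ∫ q in openSimplex s₀, ∏ s, simplexLift s₀ q s ^ (a s - 1)

variable {s₀}

theorem prod_rpow_nonneg {q : {s : S // s ≠ s₀} → ℝ} (hq : q ∈ openSimplex s₀) (a : S → ℝ) :
    0 ≤ ∏ s, simplexLift s₀ q s ^ (a s - 1) :=
  Finset.prod_nonneg fun s _ => Real.rpow_nonneg (hq s).le _

theorem prod_rpow_pos {q : {s : S // s ≠ s₀} → ℝ} (hq : q ∈ openSimplex s₀) (a : S → ℝ) :
    0 < ∏ s, simplexLift s₀ q s ^ (a s - 1) :=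
  Finset.prod_pos fun s _ => Real.rpow_pos_of_pos (hq s) _

/-- Parameters at least `1` make the exponents nonnegative, so the density is bounded; this gives
integrability and domination. -/
theorem prod_rpow_le_one {q : {s : S // s ≠ s₀} → ℝ} (hq : q ∈ openSimplex s₀) {a : S → ℝ}
    (ha : ∀ s, 1 ≤ a s) : ∏ s, simplexLift s₀ q s ^ (a s - 1) ≤ 1 :=
  Finset.prod_le_one (fun s _ => Real.rpow_nonneg (hq s).le _) fun s _ =>
    Real.rpow_le_one (hq s).le (simplexLift_le_one hq s) (by linarith [ha s])

omit [DecidableEq S] in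
theorem measurable_prod_rpow (a : S → ℝ) : Measurable fun p : S → ℝ => ∏ s, p s ^ (a s - 1) :=
  Finset.measurable_prod _ fun s _ => (measurable_pi_apply s).pow_const _

theorem measurable_prod_rpow_simplexLift (a : S → ℝ) :
    Measurable fun q => ∏ s, simplexLift s₀ q s ^ (a s - 1) :=
  (measurable_prod_rpow a).comp measurable_simplexLift

theorem integrable_prod_rpow {a : S → ℝ} (ha : ∀ s, 1 ≤ a s) :
    IntegrableOn (fun q => ∏ s, simplexLift s₀ q s ^ (a s - 1)) (openSimplex s₀) := by
  refine Integrable.of_bound (measurable_prod_rpow_simplexLift a).aestronglyMeasurable 1 ?_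
  filter_upwards [ae_restrict_mem measurableSet_openSimplex] with q hq
  rw [Real.norm_of_nonneg (prod_rpow_nonneg hq a)]
  exact prod_rpow_le_one hq ha

theorem dirichletIntegral_pos {a : S → ℝ} (ha : ∀ s, 1 ≤ a s) : 0 < dirichletIntegral s₀ a := by
  rw [dirichletIntegral, setIntegral_pos_iff_support_of_nonneg_ae]
  · refine lt_of_lt_of_le (isOpen_openSimplex.measure_pos volume nonempty_openSimplex)
      (measure_mono fun q hq => ⟨(prod_rpow_pos hq a).ne', hq⟩)
  · filter_upwards [ae_restrict_mem measurableSet_openSimplex] with q hq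
    exact prod_rpow_nonneg hq a
  · exact integrable_prod_rpow ha

/-- Hence moments of the Dirichlet distribution are ratios of Dirichlet integrals with shifted
parameters. -/
theorem prod_rpow_add_single {q : {s : S // s ≠ s₀} → ℝ} (hq : q ∈ openSimplex s₀) (a : S → ℝ)
    (s : S) : ∏ t, simplexLift s₀ q t ^ ((a + (Pi.single s 1 : S → ℝ)) t - 1) =
      simplexLift s₀ q s * ∏ t, simplexLift s₀ q t ^ (a t - 1) := by
  have h : ∀ t, simplexLift s₀ q t ^ ((a + (Pi.single s 1 : S → ℝ)) t - 1) =
      (if t = s then simplexLift s₀ q s else 1) * simplexLift s₀ q t ^ (a t - 1) := by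
    intro t
    rw [Pi.add_apply, show a t + Pi.single (M := fun _ => ℝ) s 1 t - 1 =
      Pi.single (M := fun _ => ℝ) s 1 t + (a t - 1) by ring,
      Real.rpow_add (hq t)]
    congr 1
    split_ifs with hts
    · subst hts
      simp
    · simp [hts]
  rw [Finset.prod_congr rfl fun t _ => h t, Finset.prod_mul_distrib]
  simp

omit [Fintype S] in
theorem one_le_add_single {a : S → ℝ} (ha : ∀ s, 1 ≤ a s) (s t : S) :
    1 ≤ (a + (Pi.single s 1 : S → ℝ)) t := by
  have : (0 : ℝ) ≤ Pi.single (M := fun _ => ℝ) s 1 t := by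
    rcases eq_or_ne t s with rfl | h <;> simp [*]
  rw [Pi.add_apply]
  linarith [ha t]

/-- The density is multiplied by `∑ s, p s = 1` and the sum is expanded. -/
theorem sum_dirichletIntegral_add_single {a : S → ℝ} (ha : ∀ s, 1 ≤ a s) :
    ∑ s, dirichletIntegral s₀ (a + (Pi.single s 1 : S → ℝ)) = dirichletIntegral s₀ a := by
  simp only [dirichletIntegral]
  rw [← integral_finsetSum _ fun s _ => integrable_prod_rpow (one_le_add_single ha s)]
  refine setIntegral_congr_fun measurableSet_openSimplex fun q hq => ?_
  rw [Finset.sum_congr rfl fun s _ => prod_rpow_add_single hq a s, ← Finset.sum_mul,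
    sum_simplexLift, one_mul]

theorem tendsto_dirichletIntegral {a : S → ℝ} (ha : ∀ s, 1 ≤ a s) :
    Tendsto (fun n : ℕ => dirichletIntegral s₀ (a + fun _ => 1 / ((n : ℝ) + 1))) atTop
      (𝓝 (dirichletIntegral s₀ a)) := by
  refine tendsto_integral_of_dominated_convergence (fun _ => (1 : ℝ)) ?_ (integrable_const _) ?_ ?_
  · exact fun n => (measurable_prod_rpow_simplexLift _).aestronglyMeasurable
  · intro n
    filter_upwards [ae_restrict_mem measurableSet_openSimplex] with q hq
    rw [Real.norm_of_nonneg (prod_rpow_nonneg hq _)]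
    refine prod_rpow_le_one hq fun s => ?_
    have : 0 < 1 / ((n : ℝ) + 1) := by positivity
    simp only [Pi.add_apply]
    linarith [ha s]
  · filter_upwards [ae_restrict_mem measurableSet_openSimplex] with q hq
    refine tendsto_finsetProd _ fun s _ => ?_
    refine Tendsto.rpow tendsto_const_nhds ?_ (Or.inl (hq s).ne')
    have := (tendsto_one_div_add_atTop_nhds_zero_nat (𝕜 := ℝ)).const_add (a s)
    simpa using this.sub_const 1

end DirichletIntegral

/-! ### Integration by parts on the simplex and moments of the Dirichlet distribution -/

section Moments

/-- For `b > 1` the truncated power is differentiable across `0`. Densities extended by zero can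
then be differentiated on the whole space, and integration by parts has no boundary term. -/
theorem hasDerivAt_max_zero_rpow {b : ℝ} (hb : 1 < b) (x : ℝ) :
    HasDerivAt (fun y => max y 0 ^ b) (b * max x 0 ^ (b - 1)) x := by
  rcases lt_trichotomy x 0 with hx | rfl | hx
  · rw [max_eq_right hx.le, Real.zero_rpow (by linarith), mul_zero]
    refine (hasDerivAt_const x (0 : ℝ)).congr_of_eventuallyEq ?_
    filter_upwards [gt_mem_nhds hx] with y hy
    rw [max_eq_right hy.le, Real.zero_rpow (by linarith)]
  -- At `0` the truncated power is dominated by `y ^ b`, whose derivative vanishes there.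
  · rw [max_self, Real.zero_rpow (by linarith), mul_zero, hasDerivAt_iff_isLittleO]
    have h1 := (hasDerivAt_iff_isLittleO.1
      (Real.hasDerivAt_rpow_const (x := 0) (p := b) (Or.inr hb.le)))
    rw [Real.zero_rpow (by linarith : b - 1 ≠ 0)] at h1
    refine Asymptotics.IsBigO.trans_isLittleO (Asymptotics.IsBigO.of_bound 1 ?_) h1
    refine Eventually.of_forall fun y => ?_
    have hb0 : b ≠ 0 := by linarith
    rcases le_total y 0 with hy | hy
    · simp [max_eq_right hy, Real.zero_rpow hb0]
    · simp [max_eq_left hy]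
  · rw [max_eq_left hx.le]
    refine (Real.hasDerivAt_rpow_const (p := b) (Or.inl hx.ne')).congr_of_eventuallyEq ?_
    filter_upwards [lt_mem_nhds hx] with y hy
    rw [max_eq_left hy.le]

variable {S : Type*} [Fintype S] [DecidableEq S] {s₀ : S}

/-- The density of a Dirichlet distribution, extended by zero. -/
noncomputable def dirichletDensity (s₀ : S) (a : S → ℝ) (q : {s : S // s ≠ s₀} → ℝ) : ℝ :=
  ∏ s, max (simplexLift s₀ q s) 0 ^ (a s - 1)

theorem dirichletDensity_of_mem {q : {s : S // s ≠ s₀} → ℝ} (hq : q ∈ openSimplex s₀)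
    (a : S → ℝ) : dirichletDensity s₀ a q = ∏ s, simplexLift s₀ q s ^ (a s - 1) :=
  Finset.prod_congr rfl fun s _ => by rw [max_eq_left (hq s).le]

theorem dirichletDensity_of_notMem {q : {s : S // s ≠ s₀} → ℝ} (hq : q ∉ openSimplex s₀)
    {a : S → ℝ} (ha : ∀ s, 1 < a s) : dirichletDensity s₀ a q = 0 := by
  have : ∃ s, simplexLift s₀ q s ≤ 0 := by simpa [openSimplex] using hq
  obtain ⟨s, hs⟩ := this
  refine Finset.prod_eq_zero (Finset.mem_univ s) ?_
  rw [max_eq_right hs, Real.zero_rpow (by linarith [ha s])]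

theorem continuous_dirichletDensity {a : S → ℝ} (ha : ∀ s, 1 < a s) :
    Continuous (dirichletDensity s₀ a) := by
  refine continuous_finsetProd _ fun s _ => ?_
  refine Continuous.rpow_const ?_ fun q => Or.inr (by linarith [ha s])
  exact ((continuous_apply s).comp continuous_simplexLift).max continuous_const

theorem integrable_dirichletDensity {a : S → ℝ} (ha : ∀ s, 1 < a s) :
    Integrable (dirichletDensity s₀ a) :=
  (continuous_dirichletDensity ha).integrable_of_hasCompactSupport
    (HasCompactSupport.intro (K := Set.Icc 0 1) isCompact_Icc fun _ hq =>
      dirichletDensity_of_notMem (fun h => hq (openSimplex_subset_Icc h)) ha)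

theorem integral_dirichletDensity {a : S → ℝ} (ha : ∀ s, 1 < a s) :
    ∫ q, dirichletDensity s₀ a q = dirichletIntegral s₀ a := by
  rw [← setIntegral_eq_integral_of_forall_compl_eq_zero
    (s := openSimplex s₀) fun q hq => dirichletDensity_of_notMem hq ha]
  exact setIntegral_congr_fun measurableSet_openSimplex fun q hq => dirichletDensity_of_mem hq a

/-- Moving `q i` alone changes only two factors, that of `i` and that of the dependent coordinate
`s₀`; they are isolated here. -/
theorem dirichletDensity_eq_mul (i : {s : S // s ≠ s₀}) (b : S → ℝ)
    (q : {s : S // s ≠ s₀} → ℝ) :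
    dirichletDensity s₀ b q = max (q i) 0 ^ (b i - 1) *
      (∏ j ∈ Finset.univ.erase i, max (q j) 0 ^ (b j - 1)) *
        max (1 - ∑ j, q j) 0 ^ (b s₀ - 1) := by
  rw [dirichletDensity, Fintype.prod_eq_mul_prod_subtype_ne _ s₀, simplexLift_self, mul_comm]
  simp only [simplexLift_coe]
  rw [Finset.mul_prod_erase _ (fun j : {s : S // s ≠ s₀} => max (q j) 0 ^ (b j - 1))
    (Finset.mem_univ i)]

omit [Fintype S] in
theorem one_lt_add_single {a : S → ℝ} (ha : ∀ s, 1 < a s) (s t : S) :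
    1 < (a + (Pi.single s 1 : S → ℝ)) t := by
  have : (0 : ℝ) ≤ (Pi.single s 1 : S → ℝ) t := by
    rcases eq_or_ne t s with rfl | h <;> simp [*]
  rw [Pi.add_apply]
  linarith [ha t]

/-- Integration by parts in the direction `q i`, applied to `f = q i ^ a i` times the inert factors
`h` and `g = p s₀ ^ a s₀`. Differentiating `f` lowers the exponent at `i` and yields `a i`;
differentiating `g` lowers the one at `s₀` and yields `-a s₀`. -/
theorem mul_dirichletIntegral_add_single_of_one_lt {a : S → ℝ} (ha : ∀ s, 1 < a s)
    (i : {s : S // s ≠ s₀}) :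
    a i * dirichletIntegral s₀ (a + (Pi.single s₀ 1 : S → ℝ)) =
      a s₀ * dirichletIntegral s₀ (a + (Pi.single (i : S) 1 : S → ℝ)) := by
  set h : ({s : S // s ≠ s₀} → ℝ) → ℝ :=
    fun q => ∏ j ∈ Finset.univ.erase i, max (q j) 0 ^ (a j - 1) with hh
  have hi0 : (s₀ : S) ≠ i := i.2.symm
  have herase : ∀ (b : S → ℝ), (∀ j : {s : S // s ≠ s₀}, j ≠ i → b j = a j) → ∀ q,
      ∏ j ∈ Finset.univ.erase i, max (q j) 0 ^ (b j - 1) = h q := fun b hb q =>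
    Finset.prod_congr rfl fun j hj => by rw [hb j (Finset.ne_of_mem_erase hj)]
  set f : ({s : S // s ≠ s₀} → ℝ) → ℝ := fun q => max (q i) 0 ^ a i * h q with hf
  set f' : ({s : S // s ≠ s₀} → ℝ) → ℝ :=
    fun q => a i * max (q i) 0 ^ (a i - 1) * h q with hf'
  set g : ({s : S // s ≠ s₀} → ℝ) → ℝ := fun q => max (1 - ∑ j, q j) 0 ^ a s₀ with hg
  set g' : ({s : S // s ≠ s₀} → ℝ) → ℝ :=
    fun q => -(a s₀ * max (1 - ∑ j, q j) 0 ^ (a s₀ - 1)) with hg'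
  have e1 : ∀ q, f' q * g q = a i * dirichletDensity s₀ (a + (Pi.single s₀ 1 : S → ℝ)) q := by
    intro q
    rw [dirichletDensity_eq_mul i, herase _ (fun j _ => by simp [j.2])]
    simp only [hf', hg, Pi.add_apply, Pi.single_eq_same, Pi.single_eq_of_ne hi0.symm, add_zero,
      add_sub_cancel_right]
    ring
  have e2 : ∀ q, f q * g' q =
      -(a s₀ * dirichletDensity s₀ (a + (Pi.single (i : S) 1 : S → ℝ)) q) := by
    intro q
    rw [dirichletDensity_eq_mul i, herase _ (fun j hj => by
      simp [Subtype.coe_injective.ne hj])]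
    simp only [hf, hg', Pi.add_apply, Pi.single_eq_same, Pi.single_eq_of_ne hi0, add_zero,
      add_sub_cancel_right]
    ring
  -- The undifferentiated product is a Dirichlet density with both parameters raised, which supplies
  -- its integrability.
  have e3 : ∀ q, f q * g q = dirichletDensity s₀
      (a + (Pi.single s₀ 1 : S → ℝ) + (Pi.single (i : S) 1 : S → ℝ)) q := by
    intro q
    rw [dirichletDensity_eq_mul i, herase _ (fun j hj => by
      simp [Subtype.coe_injective.ne hj, j.2])]
    simp only [hf, hg, Pi.add_apply, Pi.single_eq_same, Pi.single_eq_of_ne hi0,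
      Pi.single_eq_of_ne hi0.symm, add_zero, add_sub_cancel_right]
  have hline : ∀ (q : {s : S // s ≠ s₀} → ℝ) (t : ℝ) (j : {s : S // s ≠ s₀}),
      (q + t • (Pi.single i 1 : {s : S // s ≠ s₀} → ℝ)) j = if j = i then q i + t else q j := by
    intro q t j
    split_ifs with hj
    · subst hj
      simp
    · simp [hj]
  have hinv : ∀ q t, h (q + t • (Pi.single i 1 : {s : S // s ≠ s₀} → ℝ)) = h q := fun q t =>
    Finset.prod_congr rfl fun j hj => by rw [hline, if_neg (Finset.ne_of_mem_erase hj)]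
  have hdf : ∀ q, HasLineDerivAt ℝ f (f' q) q (Pi.single i 1) := by
    intro q
    have hd := hasDerivAt_max_zero_rpow (ha i) (q i + 0)
    have := (hd.comp_const_add (q i) 0).mul_const (h q)
    rw [add_zero] at this
    refine this.congr_of_eventuallyEq (Eventually.of_forall fun t => ?_)
    simp only [hf]
    rw [hinv, hline, if_pos rfl]
  have hdg : ∀ q, HasLineDerivAt ℝ g (g' q) q (Pi.single i 1) := by
    intro q
    have hd := hasDerivAt_max_zero_rpow (ha s₀) ((1 - ∑ j, q j) - 0)
    have := hd.comp_const_sub (1 - ∑ j, q j) 0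
    rw [sub_zero] at this
    refine this.congr_of_eventuallyEq (Eventually.of_forall fun t => ?_)
    simp only [hg]
    congr 2
    simp only [Pi.add_apply, Finset.sum_add_distrib, Pi.smul_apply, smul_eq_mul,
      ← Finset.mul_sum, Finset.sum_pi_single', Finset.mem_univ, if_true]
    simp
    ring
  have key := integral_bilinear_hasLineDerivAt_right_eq_neg_left_of_integrable
    (μ := (volume : Measure ({s : S // s ≠ s₀} → ℝ))) (B := ContinuousLinearMap.mul ℝ ℝ)
    (f := f) (f' := f') (g := g) (g' := g') (v := Pi.single i 1)
    (by
      simp only [ContinuousLinearMap.mul_apply', e1]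
      exact (integrable_dirichletDensity (one_lt_add_single ha _)).const_mul _)
    (by
      simp only [ContinuousLinearMap.mul_apply', e2]
      exact ((integrable_dirichletDensity (one_lt_add_single ha _)).const_mul _).neg)
    (by
      simp only [ContinuousLinearMap.mul_apply', e3]
      exact integrable_dirichletDensity (one_lt_add_single (one_lt_add_single ha _) _))
    (fun q _ => hdf q) (fun q _ => hdg q)
  simp only [ContinuousLinearMap.mul_apply', e1, e2] at key
  rw [integral_neg, integral_const_mul, integral_const_mul,
    integral_dirichletDensity (one_lt_add_single ha _),
    integral_dirichletDensity (one_lt_add_single ha _)] at key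
  linarith

/-- Integration by parts needs parameters above `1`; the value `1` is reached by shifting all of
them by `1 / (n + 1)` and passing to the limit. -/
theorem mul_dirichletIntegral_add_single {a : S → ℝ} (ha : ∀ s, 1 ≤ a s)
    (i : {s : S // s ≠ s₀}) :
    a i * dirichletIntegral s₀ (a + (Pi.single s₀ 1 : S → ℝ)) =
      a s₀ * dirichletIntegral s₀ (a + (Pi.single (i : S) 1 : S → ℝ)) := by
  have hδ : Tendsto (fun n : ℕ => 1 / ((n : ℝ) + 1)) atTop (𝓝 0) :=
    tendsto_one_div_add_atTop_nhds_zero_nat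
  have hlim : ∀ s t : S, Tendsto (fun n : ℕ => (a s + 1 / ((n : ℝ) + 1)) *
      dirichletIntegral s₀ ((a + fun _ => 1 / ((n : ℝ) + 1)) + (Pi.single t 1 : S → ℝ))) atTop
      (𝓝 (a s * dirichletIntegral s₀ (a + (Pi.single t 1 : S → ℝ)))) := by
    intro s t
    refine Tendsto.mul (by simpa using hδ.const_add (a s)) ?_
    simp only [add_right_comm a]
    exact tendsto_dirichletIntegral (one_le_add_single ha t)
  refine tendsto_nhds_unique (hlim i s₀) ((hlim s₀ i).congr fun n => ?_)
  refine (mul_dirichletIntegral_add_single_of_one_lt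
    (a := a + fun _ => 1 / ((n : ℝ) + 1)) (fun s => ?_) i).symm
  have : 0 < 1 / ((n : ℝ) + 1) := by positivity
  simp only [Pi.add_apply]
  linarith [ha s]

/-- The integrals with one parameter raised are proportional to the parameters, and their sum is the
original integral, which fixes the constant. -/
theorem dirichletIntegral_add_single {a : S → ℝ} (ha : ∀ s, 1 ≤ a s) (s : S) :
    (∑ t, a t) * dirichletIntegral s₀ (a + (Pi.single s 1 : S → ℝ)) =
      a s * dirichletIntegral s₀ a := by
  have hrel : ∀ t, a t * dirichletIntegral s₀ (a + (Pi.single s₀ 1 : S → ℝ)) =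
      a s₀ * dirichletIntegral s₀ (a + (Pi.single t 1 : S → ℝ)) := by
    intro t
    by_cases ht : t = s₀
    · rw [ht]
    · exact mul_dirichletIntegral_add_single ha ⟨t, ht⟩
  have h0 : (∑ t, a t) * dirichletIntegral s₀ (a + (Pi.single s₀ 1 : S → ℝ)) =
      a s₀ * dirichletIntegral s₀ a := by
    rw [Finset.sum_mul, Finset.sum_congr rfl fun t _ => hrel t, ← Finset.mul_sum,
      sum_dirichletIntegral_add_single ha]
  have hpos : 0 < a s₀ := by linarith [ha s₀]
  refine mul_left_cancel₀ hpos.ne' ?_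
  calc a s₀ * ((∑ t, a t) * dirichletIntegral s₀ (a + (Pi.single s 1 : S → ℝ)))
      = (∑ t, a t) * (a s₀ * dirichletIntegral s₀ (a + (Pi.single s 1 : S → ℝ))) := by ring
    _ = a s * ((∑ t, a t) * dirichletIntegral s₀ (a + (Pi.single s₀ 1 : S → ℝ))) := by
        rw [← hrel s]
        ring
    _ = _ := by
        rw [h0]
        ring

end Moments

/-! ### The Dirichlet distribution -/

section Dirichlet

variable {S : Type*} [Fintype S] [DecidableEq S] [Nonempty S] {a : S → ℝ}

omit [DecidableEq S] [Nonempty S] in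
theorem measurable_ofReal_prod_rpow (a : S → ℝ) :
    Measurable fun p : S → ℝ => ENNReal.ofReal (∏ s, p s ^ (a s - 1)) :=
  (measurable_prod_rpow a).ennreal_ofReal

/-- The density is positive on the open simplex, so the null sets are those of Lebesgue measure
there, whatever `a` is. -/
theorem dirichletWeight_apply_eq_zero_iff {T : Set (S → ℝ)} (hT : MeasurableSet T) :
    dirichletWeight a T = 0 ↔ volume (openSimplex (Classical.arbitrary S) ∩ simplexLift (Classical.arbitrary S) ⁻¹' T) = 0 := by
  have hms : MeasurableSet ({p : S → ℝ | ENNReal.ofReal (∏ s, p s ^ (a s - 1)) ≠ 0} ∩ T) :=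
    ((measurable_ofReal_prod_rpow a) (measurableSet_singleton 0).compl).inter hT
  rw [dirichletWeight, withDensity_apply_eq_zero (measurable_ofReal_prod_rpow a),
    simplexVolume_eq_map, Measure.map_apply measurable_simplexLift
      hms,
    Measure.restrict_apply' measurableSet_openSimplex, Set.inter_comm]
  refine Eq.congr (congrArg _ (Set.ext fun q => and_congr_right fun hq => ?_)) rfl
  simp only [Set.mem_preimage, Set.mem_inter_iff, ne_eq,
    ENNReal.ofReal_eq_zero, not_le, and_iff_right_iff_imp]
  exact fun _ => prod_rpow_pos hq a

theorem dirichletWeight_univ (ha : ∀ s, 1 ≤ a s) :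
    dirichletWeight a Set.univ = ENNReal.ofReal (dirichletIntegral (Classical.arbitrary S) a) := by
  rw [dirichletWeight, withDensity_apply _ MeasurableSet.univ, Measure.restrict_univ,
    simplexVolume_eq_map, lintegral_map (measurable_ofReal_prod_rpow a) measurable_simplexLift,
    dirichletIntegral, ofReal_integral_eq_lintegral_ofReal (integrable_prod_rpow ha)]
  filter_upwards [ae_restrict_mem measurableSet_openSimplex] with q hq
  exact prod_rpow_nonneg hq a

theorem dirichletWeight_univ_ne_zero (ha : ∀ s, 1 ≤ a s) : dirichletWeight a Set.univ ≠ 0 := by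
  rw [dirichletWeight_univ ha, ne_eq, ENNReal.ofReal_eq_zero, not_le]
  exact dirichletIntegral_pos ha

theorem dirichletWeight_univ_ne_top (ha : ∀ s, 1 ≤ a s) : dirichletWeight a Set.univ ≠ ⊤ := by
  rw [dirichletWeight_univ ha]
  exact ENNReal.ofReal_ne_top

theorem isProbabilityMeasure_dirichlet (ha : ∀ s, 1 ≤ a s) :
    IsProbabilityMeasure (dirichlet a) := by
  constructor
  rw [dirichlet, Measure.smul_apply, smul_eq_mul,
    ENNReal.inv_mul_cancel (dirichletWeight_univ_ne_zero ha) (dirichletWeight_univ_ne_top ha)]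

theorem dirichlet_apply_eq_zero_iff (ha : ∀ s, 1 ≤ a s) {T : Set (S → ℝ)}
    (hT : MeasurableSet T) :
    dirichlet a T = 0 ↔ volume (openSimplex (Classical.arbitrary S) ∩ simplexLift (Classical.arbitrary S) ⁻¹' T) = 0 := by
  rw [dirichlet, Measure.smul_apply, smul_eq_mul, mul_eq_zero,
    dirichletWeight_apply_eq_zero_iff hT, ENNReal.inv_eq_zero]
  exact or_iff_right (dirichletWeight_univ_ne_top ha)

theorem ae_dirichlet_mem_stdSimplex (ha : ∀ s, 1 ≤ a s) :
    ∀ᵐ p ∂dirichlet a, p ∈ stdSimplex ℝ S := by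
  rw [ae_iff]
  refine (dirichlet_apply_eq_zero_iff ha (isClosed_stdSimplex ℝ S).measurableSet.compl).2 ?_
  have : openSimplex (Classical.arbitrary S) ∩ simplexLift (Classical.arbitrary S) ⁻¹' (stdSimplex ℝ S)ᶜ = ∅ := by
    ext q
    simp only [Set.mem_inter_iff, Set.mem_preimage, Set.mem_compl_iff, Set.mem_empty_iff_false,
      iff_false, not_and, not_not]
    exact fun hq => simplexLift_mem_stdSimplex.2 fun s => (hq s).le
  rw [this, measure_empty]

theorem exists_mem_openSimplex_of_dirichlet_ne_zero (ha : ∀ s, 1 ≤ a s) {T : Set (S → ℝ)}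
    (hT : MeasurableSet T) (h : dirichlet a T ≠ 0) :
    ∃ q ∈ openSimplex (Classical.arbitrary S), simplexLift (Classical.arbitrary S) q ∈ T := by
  by_contra hne
  push Not at hne
  refine h ((dirichlet_apply_eq_zero_iff ha hT).2 ?_)
  have : openSimplex (Classical.arbitrary S) ∩ simplexLift (Classical.arbitrary S) ⁻¹' T = ∅ :=
    Set.eq_empty_of_forall_notMem fun q hq => hne q hq.1 hq.2
  rw [this, measure_empty]

theorem dirichlet_ne_zero_of_isOpen (ha : ∀ s, 1 ≤ a s) {T : Set (S → ℝ)} (hT : IsOpen T)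
    {q : {s : S // s ≠ (Classical.arbitrary S)} → ℝ} (hq : q ∈ openSimplex (Classical.arbitrary S)) (hqT : simplexLift (Classical.arbitrary S) q ∈ T) :
    dirichlet a T ≠ 0 := by
  rw [ne_eq, dirichlet_apply_eq_zero_iff ha hT.measurableSet]
  exact ((isOpen_openSimplex.inter (hT.preimage continuous_simplexLift)).measure_pos volume
    ⟨q, hq, hqT⟩).ne'

/-- A continuous random variable on the simplex has no gap above its value at risk. -/
theorem lt_measureReal_dirichlet (ha : ∀ s, 1 ≤ a s) {α B : ℝ} (hα0 : 0 < α) (hα1 : α < 1)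
    {X : (S → ℝ) → ℝ} (hXc : Continuous X) (hX : ∀ᵐ p ∂dirichlet a, |X p| ≤ B) {ε : ℝ}
    (hε : 0 < ε) :
    α < (dirichlet a).real {p | X p ≤ valueAtRisk α (dirichlet a) X + ε} := by
  have := isProbabilityMeasure_dirichlet ha
  set v := valueAtRisk α (dirichlet a) X with hv
  by_contra hle
  rw [not_lt] at hle
  have hms : ∀ z, MeasurableSet {p | X p ≤ z} := fun z =>
    measurableSet_le hXc.measurable measurable_const
  -- If the claim fails, `X ≤ v + ε / 3` and `X ≤ v + ε` have equal probability `α`, strictly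
  -- between `0` and `1`. Hence `X` takes values on both sides of the band between, and by
  -- connectedness the value `v + ε / 2` inside it; the band then has positive probability, a
  -- contradiction.
  have h1 : α ≤ (dirichlet a).real {p | X p ≤ v + ε / 3} :=
    le_measureReal_of_valueAtRisk_lt hα1 hX (by linarith)
  have h2 := probReal_compl_eq_one_sub (μ := dirichlet a) (hms (v + ε))
  obtain ⟨q₁, hq₁, hX₁⟩ := exists_mem_openSimplex_of_dirichlet_ne_zero ha (hms (v + ε / 3))
    (fun h => by rw [measureReal_def, h] at h1; simp at h1; linarith)
  obtain ⟨q₂, hq₂, hX₂⟩ := exists_mem_openSimplex_of_dirichlet_ne_zero ha (hms (v + ε)).compl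
    (fun h => by rw [measureReal_def, h] at h2; simp at h2; linarith)
  have hX₁' : X (simplexLift (Classical.arbitrary S) q₁) ≤ v + ε / 3 := hX₁
  have hX₂' : ¬ X (simplexLift (Classical.arbitrary S) q₂) ≤ v + ε := hX₂
  obtain ⟨q, hq, hqX⟩ := (convex_openSimplex (s₀ := (Classical.arbitrary S))).isPreconnected.intermediate_value hq₁ hq₂
    (hXc.comp continuous_simplexLift).continuousOn
    (show v + ε / 2 ∈ Set.Icc _ _ from
      ⟨by simp only [Function.comp_apply]; linarith, by simp only [Function.comp_apply]; linarith⟩)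
  have hqX' : X (simplexLift (Classical.arbitrary S) q) = v + ε / 2 := hqX
  have hO : IsOpen {p | v + ε / 3 < X p ∧ X p < v + ε} :=
    (isOpen_lt continuous_const hXc).inter (isOpen_lt hXc continuous_const)
  refine dirichlet_ne_zero_of_isOpen ha hO hq
    (show v + ε / 3 < X _ ∧ X _ < v + ε from ⟨by linarith, by linarith⟩) ?_
  have hdiff := measureReal_sdiff (μ := dirichlet a)
    (show {p | X p ≤ v + ε / 3} ⊆ {p | X p ≤ v + ε} from fun p (hp : X p ≤ _) =>
      show X p ≤ _ by linarith) (hms _)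
  have hz : (dirichlet a).real ({p | X p ≤ v + ε} \ {p | X p ≤ v + ε / 3}) = 0 :=
    le_antisymm (by linarith) measureReal_nonneg
  rw [measureReal_eq_zero_iff] at hz
  refine measure_mono_null (fun p (hp : _ ∧ _) => ?_) hz
  exact ⟨hp.2.le, not_le.2 hp.1⟩

theorem integral_dirichlet (ha : ∀ s, 1 ≤ a s) {f : (S → ℝ) → ℝ} (hf : Measurable f) :
    ∫ p, f p ∂dirichlet a = (dirichletIntegral (Classical.arbitrary S) a)⁻¹ *
      ∫ q in openSimplex (Classical.arbitrary S), (∏ s, simplexLift (Classical.arbitrary S) q s ^ (a s - 1)) * f (simplexLift (Classical.arbitrary S) q) := by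
  rw [dirichlet, integral_smul_measure, dirichletWeight_univ ha, ENNReal.toReal_inv,
    ENNReal.toReal_ofReal (dirichletIntegral_pos ha).le, smul_eq_mul, dirichletWeight,
    integral_withDensity_eq_integral_toReal_smul (measurable_ofReal_prod_rpow a)
      (ae_of_all _ fun _ => ENNReal.ofReal_lt_top), simplexVolume_eq_map,
    integral_map measurable_simplexLift.aemeasurable (f := fun p =>
      (ENNReal.ofReal (∏ s, p s ^ (a s - 1))).toReal • f p)
      ((measurable_ofReal_prod_rpow a).ennreal_toReal.smul hf).aestronglyMeasurable]
  congr 1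
  refine setIntegral_congr_fun measurableSet_openSimplex fun q hq => ?_
  simp only [smul_eq_mul]
  rw [ENNReal.toReal_ofReal (prod_rpow_nonneg hq a)]

theorem integral_dirichlet_eval (ha : ∀ s, 1 ≤ a s) (s : S) :
    ∫ p, p s ∂dirichlet a = a s / ∑ t, a t := by
  have hJ := dirichletIntegral_pos (s₀ := (Classical.arbitrary S)) ha
  have hA : 0 < ∑ t, a t := Finset.sum_pos (fun t _ => by linarith [ha t]) Finset.univ_nonempty
  have h1 := dirichletIntegral_add_single (s₀ := (Classical.arbitrary S)) ha s
  have h2 : ∫ q in openSimplex (Classical.arbitrary S), (∏ t, simplexLift (Classical.arbitrary S) q t ^ (a t - 1)) * simplexLift (Classical.arbitrary S) q s =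
      dirichletIntegral (Classical.arbitrary S) (a + (Pi.single s 1 : S → ℝ)) :=
    setIntegral_congr_fun measurableSet_openSimplex fun q hq => by
      rw [prod_rpow_add_single hq, mul_comm]
  rw [integral_dirichlet ha (measurable_pi_apply s), h2]
  field_simp
  linarith

theorem integral_dirichlet_sq (ha : ∀ s, 1 ≤ a s) (s : S) :
    ∫ p, p s ^ 2 ∂dirichlet a = a s * (a s + 1) / ((∑ t, a t) * (∑ t, a t + 1)) := by
  have hJ := dirichletIntegral_pos (s₀ := (Classical.arbitrary S)) ha
  have hA : 0 < ∑ t, a t := Finset.sum_pos (fun t _ => by linarith [ha t]) Finset.univ_nonempty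
  have h1 := dirichletIntegral_add_single (s₀ := (Classical.arbitrary S)) ha s
  have h1' := dirichletIntegral_add_single (s₀ := (Classical.arbitrary S)) (one_le_add_single ha s) s
  have hsum : ∑ t, (a + (Pi.single s 1 : S → ℝ)) t = ∑ t, a t + 1 := by
    simp [Finset.sum_add_distrib]
  rw [hsum, Pi.add_apply, Pi.single_eq_same] at h1'
  have h2 : ∫ q in openSimplex (Classical.arbitrary S),
      (∏ t, simplexLift (Classical.arbitrary S) q t ^ (a t - 1)) * simplexLift (Classical.arbitrary S) q s ^ 2 =
      dirichletIntegral (Classical.arbitrary S) (a + (Pi.single s 1 : S → ℝ) + (Pi.single s 1 : S → ℝ)) :=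
    setIntegral_congr_fun measurableSet_openSimplex fun q hq => by
      rw [prod_rpow_add_single hq, prod_rpow_add_single hq]
      ring
  rw [integral_dirichlet ha ((measurable_pi_apply s).pow_const 2), h2]
  set J := dirichletIntegral (Classical.arbitrary S) a
  set J1 := dirichletIntegral (Classical.arbitrary S) (a + (Pi.single s 1 : S → ℝ))
  set J2 := dirichletIntegral (Classical.arbitrary S) (a + (Pi.single s 1 : S → ℝ) + (Pi.single s 1 : S → ℝ))
  set A := ∑ t, a t
  have hA1 : 0 < A + 1 := by linarith
  field_simp
  linear_combination A * h1' + (a s + 1) * h1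

theorem ae_dirichlet_abs_le_one (ha : ∀ s, 1 ≤ a s) (s : S) :
    ∀ᵐ p ∂dirichlet a, |p s| ≤ 1 := by
  filter_upwards [ae_dirichlet_mem_stdSimplex ha] with p hp
  rw [abs_of_nonneg (hp.1 s), ← hp.2]
  exact Finset.single_le_sum (f := p) (fun t _ => hp.1 t) (Finset.mem_univ s)

theorem integrable_dirichlet_pow (ha : ∀ s, 1 ≤ a s) (s : S) (k : ℕ) :
    Integrable (fun p : S → ℝ => p s ^ k) (dirichlet a) := by
  have := isProbabilityMeasure_dirichlet ha
  refine Integrable.of_bound ((measurable_pi_apply s).pow_const k).aestronglyMeasurable 1 ?_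
  filter_upwards [ae_dirichlet_abs_le_one ha s] with p hp
  rw [Real.norm_eq_abs, abs_pow]
  exact pow_le_one₀ (abs_nonneg _) hp

theorem integrable_dirichlet_eval (ha : ∀ s, 1 ≤ a s) (s : S) :
    Integrable (fun p : S → ℝ => p s) (dirichlet a) := by
  simpa using integrable_dirichlet_pow ha s 1

/-- With `A` the parameter sum and `m = a s / A`, the variance is `m (1 - m) / (A + 1)`. -/
theorem integral_sq_eval_sub_le (ha : ∀ s, 1 ≤ a s) (s : S) :
    ∫ p, (p s - a s / ∑ t, a t) ^ 2 ∂dirichlet a ≤ (∑ t, a t)⁻¹ := by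
  have := isProbabilityMeasure_dirichlet ha
  have hA : 0 < ∑ t, a t := Finset.sum_pos (fun t _ => by linarith [ha t]) Finset.univ_nonempty
  have hle : a s ≤ ∑ t, a t := Finset.single_le_sum (f := a) (fun t _ => by linarith [ha t])
    (Finset.mem_univ s)
  have hi := integrable_dirichlet_eval ha s
  have hi2 := integrable_dirichlet_pow ha s 2
  have hm1 := integral_dirichlet_eval ha s
  have hm2 := integral_dirichlet_sq ha s
  have has := ha s
  generalize (∑ t, a t) = A at *
  generalize hm : a s / A = m at *
  have hexp : ∫ p, (p s - m) ^ 2 ∂dirichlet a =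
      a s * (a s + 1) / (A * (A + 1)) - 2 * m * m + m ^ 2 := by
    have e0 : ∀ p : S → ℝ, (p s - m) ^ 2 = p s ^ 2 - 2 * m * p s + m ^ 2 := fun p => by ring
    have hi3 : Integrable (fun p : S → ℝ => p s ^ 2 - 2 * m * p s) (dirichlet a) :=
      hi2.sub (hi.const_mul (2 * m))
    simp only [e0]
    rw [integral_add hi3 (integrable_const _), integral_sub hi2 (hi.const_mul (2 * m)),
      integral_const_mul, hm1, hm2]
    simp
  have heq : a s * (a s + 1) / (A * (A + 1)) - 2 * m * m + m ^ 2 =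
      A⁻¹ * (m * ((A - a s) / (A + 1))) := by
    have : A + 1 ≠ 0 := by linarith
    rw [← hm]
    field_simp
    ring
  rw [hexp, heq]
  have hm1' : m ≤ 1 := hm ▸ (div_le_one hA).2 hle
  have hx1 : (A - a s) / (A + 1) ≤ 1 := (div_le_one (by linarith)).2 (by linarith)
  have hx0 : 0 ≤ (A - a s) / (A + 1) := div_nonneg (by linarith) (by linarith)
  calc A⁻¹ * (m * ((A - a s) / (A + 1))) ≤ A⁻¹ * 1 :=
        mul_le_mul_of_nonneg_left (mul_le_one₀ hm1' hx0 hx1) (inv_pos.2 hA).le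
    _ = _ := mul_one _

omit [Fintype S] [DecidableEq S] [Nonempty S] in
-- Cauchy–Schwarz, through the pointwise bound `|f| ≤ √A / 2 * f ^ 2 + (√A)⁻¹ / 2`.
theorem integral_abs_le_of_integral_sq_le {ν : Measure (S → ℝ)} [IsProbabilityMeasure ν]
    {f : (S → ℝ) → ℝ} (hf : Integrable f ν) (hf2 : Integrable (fun p => f p ^ 2) ν) {A : ℝ}
    (hA : 0 < A) (h : ∫ p, f p ^ 2 ∂ν ≤ A⁻¹) : ∫ p, |f p| ∂ν ≤ (√A)⁻¹ := by
  have hR : 0 < √A := Real.sqrt_pos.2 hA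
  have hpt : ∀ p, |f p| ≤ √A / 2 * f p ^ 2 + (√A)⁻¹ / 2 := by
    intro p
    rw [← sq_abs (f p)]
    have : √A / 2 * |f p| ^ 2 + (√A)⁻¹ / 2 - |f p| = (√A)⁻¹ / 2 * (√A * |f p| - 1) ^ 2 := by
      field_simp
      ring
    have h0 : 0 ≤ (√A)⁻¹ / 2 * (√A * |f p| - 1) ^ 2 := by positivity
    linarith
  calc ∫ p, |f p| ∂ν ≤ ∫ p, (√A / 2 * f p ^ 2 + (√A)⁻¹ / 2) ∂ν :=
        integral_mono hf.abs ((hf2.const_mul _).add (integrable_const _)) hpt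
    _ = √A / 2 * (∫ p, f p ^ 2 ∂ν) + (√A)⁻¹ / 2 := by
        rw [integral_add (hf2.const_mul _) (integrable_const _), integral_const_mul]
        simp
    _ ≤ √A / 2 * A⁻¹ + (√A)⁻¹ / 2 := by gcongr
    _ = (√A)⁻¹ := by
        have : √A * A⁻¹ = (√A)⁻¹ := by
          rw [← div_eq_mul_inv, Real.sqrt_div_self', one_div]
        linarith

/-- The Dirichlet distribution concentrates as the sum of the parameters grows. -/
theorem integral_abs_eval_sub_le (ha : ∀ s, 1 ≤ a s) (s : S) :
    ∫ p, |p s - a s / ∑ t, a t| ∂dirichlet a ≤ (√(∑ t, a t))⁻¹ := by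
  have := isProbabilityMeasure_dirichlet ha
  have hi := integrable_dirichlet_eval ha s
  refine integral_abs_le_of_integral_sq_le (hi.sub (integrable_const _)) ?_
    (Finset.sum_pos (fun t _ => by linarith [ha t]) Finset.univ_nonempty)
    (integral_sq_eval_sub_le ha s)
  change Integrable (fun p : S → ℝ => (p s - a s / ∑ t, a t) ^ 2) _
  simp only [sub_sq]
  refine ((integrable_dirichlet_pow ha s 2).sub ?_).add (integrable_const _)
  exact (hi.const_mul 2).mul_const _

end Dirichlet

/-! ### Bias of the estimators for linear functionals of a Dirichlet sample -/

section LinearBias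

variable {S : Type*} [Fintype S] {a : S → ℝ} {α : ℝ}

/-- The mean of `c` under the probability vector `p`. -/
def weightedMean (c p : S → ℝ) : ℝ := ∑ s, p s * c s

theorem continuous_weightedMean (c : S → ℝ) : Continuous (weightedMean c) := by
  unfold weightedMean
  fun_prop

theorem measurable_weightedMean (c : S → ℝ) : Measurable (weightedMean c) := by
  unfold weightedMean
  fun_prop

theorem abs_weightedMean_sub_le {c c' p : S → ℝ} (hp : p ∈ stdSimplex ℝ S) {δ : ℝ}
    (h : ∀ s, |c s - c' s| ≤ δ) : |weightedMean c p - weightedMean c' p| ≤ δ := by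
  rw [weightedMean, weightedMean, ← Finset.sum_sub_distrib]
  calc |∑ s, (p s * c s - p s * c' s)| ≤ ∑ s, |p s * c s - p s * c' s| :=
        Finset.abs_sum_le_sum_abs _ _
    _ ≤ ∑ s, p s * δ := Finset.sum_le_sum fun s _ => by
        rw [← mul_sub, abs_mul, abs_of_nonneg (hp.1 s)]
        exact mul_le_mul_of_nonneg_left (h s) (hp.1 s)
    _ = δ := by rw [← Finset.sum_mul, hp.2, one_mul]

theorem abs_weightedMean_le {c p : S → ℝ} (hp : p ∈ stdSimplex ℝ S) {C : ℝ}
    (h : ∀ s, |c s| ≤ C) : |weightedMean c p| ≤ C := by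
  have := abs_weightedMean_sub_le (c' := 0) hp (δ := C) (by simpa using h)
  simpa [weightedMean] using this

theorem measurable_riskEstimator_weightedMean (ρ : RiskKind) (α : ℝ) (c : S → ℝ) (N : ℕ) :
    Measurable fun q : Fin N → S → ℝ => riskEstimator ρ α fun i => weightedMean c (q i) :=
  (measurable_riskEstimator ρ α).comp (measurable_pi_lambda _ fun i =>
    (measurable_weightedMean c).comp (measurable_pi_apply i))

variable [DecidableEq S] [Nonempty S]

/-- The distance between the mean of the estimator from `N` samples of the Dirichlet distribution
and the risk of a linear functional. -/
noncomputable def dirichletBias (ρ : RiskKind) (α : ℝ) (a c : S → ℝ) (N : ℕ) : ℝ :=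
  |∫ p, riskEstimator ρ α (fun i : Fin N => weightedMean c (p i))
    ∂(Measure.pi fun _ => dirichlet a) - risk ρ α (dirichlet a) (weightedMean c)|

theorem ae_dirichlet_abs_weightedMean_le (ha : ∀ s, 1 ≤ a s) {c : S → ℝ} {C : ℝ}
    (hc : ∀ s, |c s| ≤ C) : ∀ᵐ p ∂dirichlet a, |weightedMean c p| ≤ C :=
  (ae_dirichlet_mem_stdSimplex ha).mono fun _ hp => abs_weightedMean_le hp hc

theorem integrable_weightedMean (ha : ∀ s, 1 ≤ a s) (c : S → ℝ) :
    Integrable (weightedMean c) (dirichlet a) := by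
  unfold weightedMean
  exact integrable_finsetSum _ fun s _ => (integrable_dirichlet_eval ha s).mul_const _

theorem integral_abs_weightedMean_sub_le (ha : ∀ s, 1 ≤ a s) {c : S → ℝ} {C : ℝ}
    (hc : ∀ s, |c s| ≤ C) :
    ∫ p, |weightedMean c p - weightedMean c (fun s => a s / ∑ t, a t)| ∂dirichlet a ≤
      Fintype.card S * C * (√(∑ t, a t))⁻¹ := by
  have := isProbabilityMeasure_dirichlet ha
  have hi : ∀ s, Integrable (fun p : S → ℝ => |p s - a s / ∑ t, a t| * C) (dirichlet a) :=
    fun s => (((integrable_dirichlet_eval ha s).sub (integrable_const _)).abs).mul_const C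
  have hC : 0 ≤ C := (abs_nonneg _).trans (hc (Classical.arbitrary S))
  calc _ ≤ ∫ p, ∑ s, |p s - a s / ∑ t, a t| * C ∂dirichlet a := by
        refine integral_mono
          ((integrable_weightedMean ha c).sub (integrable_const _)).abs
          (integrable_finsetSum _ fun s _ => hi s) fun p => ?_
        simp only [weightedMean]
        rw [← Finset.sum_sub_distrib]
        refine (Finset.abs_sum_le_sum_abs _ _).trans (Finset.sum_le_sum fun s _ => ?_)
        rw [← sub_mul, abs_mul]
        exact mul_le_mul_of_nonneg_left (hc s) (abs_nonneg _)
    _ = ∑ s, (∫ p, |p s - a s / ∑ t, a t| ∂dirichlet a) * C := by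
        rw [integral_finsetSum _ fun s _ => hi s]
        simp only [integral_mul_const]
    _ ≤ ∑ _s : S, (√(∑ t, a t))⁻¹ * C := Finset.sum_le_sum fun s _ =>
        mul_le_mul_of_nonneg_right (integral_abs_eval_sub_le ha s) hC
    _ = _ := by
        rw [Finset.sum_const, Finset.card_univ, nsmul_eq_mul]
        ring

/-- The bias vanishes as the sum of the parameters grows, uniformly in the sample size. -/
theorem dirichletBias_le_of_sum (ρ : RiskKind) (hα0 : 0 < α) (hα1 : α < 1) (ha : ∀ s, 1 ≤ a s)
    {c : S → ℝ} {C : ℝ} (hc : ∀ s, |c s| ≤ C) {N : ℕ} (hN : 1 ≤ N) :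
    dirichletBias ρ α a c N ≤
      α⁻¹ * (3 * (min α (1 - α))⁻¹ + 1) * (Fintype.card S * C * (√(∑ t, a t))⁻¹) := by
  have := isProbabilityMeasure_dirichlet ha
  have hXm := measurable_weightedMean c
  have hX := ae_dirichlet_abs_weightedMean_le ha hc
  have hXi := integrable_weightedMean ha c
  have hβ : 0 < min α (1 - α) := lt_min hα0 (by linarith)
  set μ := weightedMean c fun s => a s / ∑ t, a t
  have he := integral_abs_weightedMean_sub_le ha hc
  have hD := min_mul_quantileDeviation_le hα0 hα1 hN hXm hX μ
  have hv := mul_abs_valueAtRisk_sub_le hα0 hα1 hXm hX μ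
  have hb := abs_integral_riskEstimator_sub_risk_le ρ hα0 hα1 hN hXm hXi
  set v := valueAtRisk α (dirichlet a) (weightedMean c)
  set e := ∫ p, |weightedMean c p - μ| ∂dirichlet a
  have hXv : ∫ p, |weightedMean c p - v| ∂dirichlet a ≤ e + |v - μ| := by
    calc _ ≤ ∫ p, (|weightedMean c p - μ| + |v - μ|) ∂dirichlet a := by
          refine integral_mono (hXi.sub (integrable_const _)).abs
            ((hXi.sub (integrable_const _)).abs.add (integrable_const _)) fun p => ?_
          simp only
          rw [abs_sub_comm v]
          exact abs_sub_le _ _ _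
      _ = _ := by
          have hi : Integrable (fun p => |weightedMean c p - μ|) (dirichlet a) :=
            (hXi.sub (integrable_const _)).abs
          rw [integral_add hi (integrable_const _)]
          simp [e]
  rw [← le_inv_mul_iff₀ hβ] at hD hv
  have hI : 0 ≤ ∫ p, |weightedMean c p - v| ∂dirichlet a := integral_nonneg fun _ => abs_nonneg _
  -- `N` may stay bounded here, so the rounding factor need not be small; smallness comes from the
  -- mean of `|X - v|`.
  have hfrac : α⁻¹ - N / ⌈(N : ℝ) * α⌉₊ ≤ α⁻¹ := sub_le_self _ (by positivity)
  have hαi : 0 < α⁻¹ := inv_pos.2 hα0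
  calc dirichletBias ρ α a c N
      ≤ α⁻¹ * quantileDeviation α (dirichlet a) (weightedMean c) N +
        α⁻¹ * ∫ p, |weightedMean c p - v| ∂dirichlet a :=
        hb.trans (by gcongr)
    _ ≤ α⁻¹ * ((min α (1 - α))⁻¹ * (2 * e)) + α⁻¹ * (e + (min α (1 - α))⁻¹ * e) := by
        gcongr
        linarith
    _ = α⁻¹ * (3 * (min α (1 - α))⁻¹ + 1) * e := by ring
    _ ≤ _ := by gcongr

/-- The bias vanishes as the sample size grows, uniformly in the linear functional. -/
theorem eventually_dirichletBias_le (ρ : RiskKind) (hα0 : 0 < α) (hα1 : α < 1)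
    (ha : ∀ s, 1 ≤ a s) (C : ℝ) {ε : ℝ} (hε : 0 < ε) :
    ∀ᶠ N : ℕ in atTop, ∀ c : S → ℝ, (∀ s, |c s| ≤ C) → dirichletBias ρ α a c N ≤ ε := by
  have := isProbabilityMeasure_dirichlet ha
  -- On a `δ`-net the quantile deviation is below `δ`, and off the net it grows by at most `2 * δ`;
  -- `α⁻¹ * (4 * δ) = ε / 2` leaves the other half for rounding.
  set δ := α * ε / 8 with hδdef
  have hδ : 0 < δ := by positivity
  have hcomp : IsCompact (Set.univ.pi fun _ : S => Set.Icc (-C) C) :=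
    isCompact_univ_pi fun _ => isCompact_Icc
  have hmem : ∀ c : S → ℝ, c ∈ (Set.univ.pi fun _ : S => Set.Icc (-C) C) ↔ ∀ s, |c s| ≤ C :=
    fun c => by simp only [Set.mem_univ_pi, Set.mem_Icc, abs_le]
  -- Consistency holds for each functional separately; a finite net of the cube makes it uniform.
  obtain ⟨t, htsub, htfin, htcov⟩ := hcomp.finite_cover_balls hδ
  have h1 : ∀ᶠ N : ℕ in atTop, ∀ c ∈ t,
      quantileDeviation α (dirichlet a) (weightedMean c) N < δ := by
    rw [eventually_all_finite htfin]
    intro c hc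
    have hcC := ae_dirichlet_abs_weightedMean_le ha ((hmem c).1 (htsub hc))
    exact (tendsto_quantileDeviation hα0 hα1 (measurable_weightedMean c) hcC fun η hη =>
      lt_measureReal_dirichlet ha hα0 hα1 (continuous_weightedMean c) hcC hη).eventually
        (gt_mem_nhds hδ)
  have h2 : ∀ᶠ N : ℕ in atTop, (α ^ 2)⁻¹ * (N : ℝ)⁻¹ * (2 * C) < ε / 2 := by
    have : Tendsto (fun N : ℕ => (α ^ 2)⁻¹ * (N : ℝ)⁻¹ * (2 * C)) atTop (𝓝 0) := by
      simpa using (tendsto_inv_atTop_nhds_zero_nat.const_mul ((α ^ 2)⁻¹)).mul_const (2 * C)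
    exact this.eventually (gt_mem_nhds (half_pos hε))
  filter_upwards [h1, h2, eventually_ge_atTop 1] with N hN1 hN2 hN c hc
  obtain ⟨c', hc't, hc'⟩ := Set.mem_iUnion₂.1 (htcov ((hmem c).2 hc))
  have hcC := ae_dirichlet_abs_weightedMean_le ha hc
  have hc'C := ae_dirichlet_abs_weightedMean_le ha ((hmem c').1 (htsub hc't))
  have hC : 0 ≤ C := (abs_nonneg _).trans (hc (Classical.arbitrary S))
  have hcc' : ∀ s, |c s - c' s| ≤ δ := fun s => by
    rw [← Real.dist_eq]
    exact (dist_le_pi_dist c c' s).trans (Metric.mem_ball.1 hc').le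
  have hD := quantileDeviation_le_add hα0 hα1 hN (measurable_weightedMean c) hcC
    (measurable_weightedMean c') hc'C
    ((ae_dirichlet_mem_stdSimplex ha).mono fun p hp => abs_weightedMean_sub_le hp hcc')
  have hXi := integrable_weightedMean ha c
  have hb := abs_integral_riskEstimator_sub_risk_le ρ hα0 hα1 hN (measurable_weightedMean c) hXi
  have hXv : ∫ p, |weightedMean c p - valueAtRisk α (dirichlet a) (weightedMean c)| ∂dirichlet a ≤
      2 * C := by
    have hv := abs_valueAtRisk_le hα0 hα1 hcC
    calc _ ≤ ∫ _p : S → ℝ, 2 * C ∂dirichlet a := by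
          refine integral_mono_ae (hXi.sub (integrable_const _)).abs (integrable_const _) ?_
          filter_upwards [hcC] with p hp
          exact (abs_sub _ _).trans (by linarith)
      _ = _ := by simp
  have hI : 0 ≤ ∫ p, |weightedMean c p - valueAtRisk α (dirichlet a) (weightedMean c)|
    ∂dirichlet a := integral_nonneg fun _ => abs_nonneg _
  have hαi : 0 < α⁻¹ := inv_pos.2 hα0
  calc dirichletBias ρ α a c N
      ≤ α⁻¹ * (4 * δ) + (α ^ 2)⁻¹ * (N : ℝ)⁻¹ * (2 * C) := by
        refine hb.trans (add_le_add ?_ ?_)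
        · gcongr
          linarith [hN1 c' hc't]
        · exact mul_le_mul (inv_sub_div_ceil_le hα0 hN) hXv hI (by positivity)
    _ ≤ α⁻¹ * (4 * δ) + ε / 2 := by linarith
    _ = ε := by
        rw [hδdef]
        field_simp
        ring

end LinearBias

/-! ### Growth of the posterior or of the sample size along a path -/

section Path

variable {S A : Type*} [DecidableEq S] [DecidableEq A]

/-- The number of the first `N` transitions of a batch that start from `(s, a)`. -/
def batchVisits (s : S) (a : A) (b : ℕ → S × A × S) (N : ℕ) : ℕ :=
  ((Finset.range N).filter fun i => (b i).1 = s ∧ (b i).2.1 = a).card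

/-- The number of transitions from `(s, a)` observed up to stage `t`. -/
def visits (n : ℕ → ℕ) (x : ℕ → ℕ → S × A × S) (s : S) (a : A) (t : ℕ) : ℕ :=
  ∑ τ ∈ Finset.Icc 1 t, batchVisits s a (x τ) (n τ)

variable {N₀ : ℕ} {n : ℕ → ℕ} {x : ℕ → ℕ → S × A × S} {s : S} {a : A}

theorem visits_succ (t : ℕ) :
    visits n x s a (t + 1) = visits n x s a t + batchVisits s a (x (t + 1)) (n (t + 1)) := by
  rw [visits, Finset.sum_Icc_succ_top (by omega), visits]

theorem monotone_visits : Monotone (visits n x s a) :=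
  monotone_nat_of_le_succ fun t => by rw [visits_succ]; omega

/-- An observation raises the sample size by one, or is a visit and lowers it by at most one; size
plus twice the visits therefore grows by at least one each time. -/
theorem le_batchSampleSize_add (b : ℕ → S × A × S) (M i : ℕ) :
    M + i ≤ batchSampleSize N₀ s a b M i + 2 * batchVisits s a b i := by
  induction i with
  | zero => simp [batchSampleSize]
  | succ i ih =>
    rw [batchSampleSize, batchVisits, Finset.range_add_one, Finset.filter_insert]
    rw [batchVisits] at ih
    split_ifs with h
    · rw [Finset.card_insert_of_notMem (by simp)]
      omega
    · omega

theorem le_sampleSize_add (t : ℕ) :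
    N₀ + ∑ τ ∈ Finset.Icc 1 t, n τ ≤ sampleSize N₀ n x s a t + 2 * visits n x s a t := by
  induction t with
  | zero => simp [sampleSize, visits]
  | succ t ih =>
    rw [visits_succ, sampleSize, Finset.sum_Icc_succ_top (by omega)]
    have := le_batchSampleSize_add (N₀ := N₀) (s := s) (a := a) (x (t + 1))
      (sampleSize N₀ n x s a t) (n (t + 1))
    omega

theorem le_batchSampleSize (b : ℕ → S × A × S) {M : ℕ} (hM : N₀ ≤ M) (i : ℕ) :
    N₀ ≤ batchSampleSize N₀ s a b M i := by
  induction i with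
  | zero => exact hM
  | succ i ih =>
    rw [batchSampleSize]
    split_ifs
    · exact le_max_right _ _
    · omega

theorem le_sampleSize (t : ℕ) : N₀ ≤ sampleSize N₀ n x s a t := by
  induction t with
  | zero => exact le_rfl
  | succ t ih => exact le_batchSampleSize _ ih _

theorem tendsto_sampleSize (hn : Tendsto (fun t => ∑ τ ∈ Finset.Icc 1 t, n τ) atTop atTop)
    {K : ℕ} (hK : ∀ t, visits n x s a t ≤ K) : Tendsto (sampleSize N₀ n x s a) atTop atTop := by
  rw [tendsto_atTop] at hn ⊢
  intro b
  filter_upwards [hn (b + 2 * K)] with t ht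
  have := le_sampleSize_add (N₀ := N₀) (n := n) (x := x) (s := s) (a := a) t
  have := hK t
  omega

variable {φ₀ : S → A → S → ℝ}

theorem posterior_succ (t : ℕ) (s' : S) :
    posterior φ₀ n x (t + 1) s a s' = posterior φ₀ n x t s a s' +
      (((Finset.range (n (t + 1))).filter fun i => x (t + 1) i = (s, a, s')).card : ℝ) := by
  rw [posterior, Finset.sum_Icc_succ_top (by omega), posterior, add_assoc]

theorem le_posterior (t : ℕ) (s' : S) : φ₀ s a s' ≤ posterior φ₀ n x t s a s' :=
  le_add_of_nonneg_right (Finset.sum_nonneg fun _ _ => Nat.cast_nonneg _)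

theorem sum_card_filter_eq_batchVisits [Fintype S] (b : ℕ → S × A × S) (N : ℕ) :
    ∑ s', ((Finset.range N).filter fun i => b i = (s, a, s')).card = batchVisits s a b N := by
  rw [batchVisits, Finset.card_eq_sum_card_fiberwise (f := fun i => (b i).2.2)
    (t := Finset.univ) (fun _ _ => Finset.mem_univ _)]
  refine Finset.sum_congr rfl fun s' _ => congrArg Finset.card ?_
  rw [Finset.filter_filter]
  refine Finset.filter_congr fun i _ => ?_
  rw [Prod.ext_iff, Prod.ext_iff, and_assoc]

theorem sum_posterior [Fintype S] (t : ℕ) :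
    ∑ s', posterior φ₀ n x t s a s' = ∑ s', φ₀ s a s' + visits n x s a t := by
  induction t with
  | zero => simp [posterior, visits]
  | succ t ih =>
    simp only [posterior_succ]
    rw [Finset.sum_add_distrib, ih, visits_succ,
      ← sum_card_filter_eq_batchVisits (s := s) (a := a) (x (t + 1)) (n (t + 1))]
    push_cast
    ring

/-- The visits are the sum over `s'` of the nonnegative transition counts, so no new visit means no
new count. -/
theorem posterior_eq_of_visits_eq [Fintype S] {T t : ℕ} (hTt : T ≤ t)
    (h : visits n x s a t = visits n x s a T) :
    posterior φ₀ n x t s a = posterior φ₀ n x T s a := by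
  induction t, hTt using Nat.le_induction with
  | base => rfl
  | succ t hTt ih =>
    have h1 := monotone_visits (n := n) (x := x) (s := s) (a := a) hTt
    rw [visits_succ] at h
    rw [← ih (by omega)]
    have h0 := sum_card_filter_eq_batchVisits (s := s) (a := a) (x (t + 1)) (n (t + 1))
    rw [show batchVisits s a (x (t + 1)) (n (t + 1)) = 0 by omega, Finset.sum_eq_zero_iff] at h0
    ext s'
    rw [posterior_succ, h0 s' (Finset.mem_univ _)]
    simp

/-- Along every path, the bias at stage `t` vanishes as `t` grows, uniformly in the linear
functional. -/
theorem eventually_dirichletBias_posterior_le [Fintype S] [Nonempty S] (ρ : RiskKind) {α : ℝ}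
    (hα0 : 0 < α) (hα1 : α < 1) (hφ₀ : ∀ s a s', 1 ≤ φ₀ s a s') (hN₀ : 1 ≤ N₀)
    (hn : Tendsto (fun t => ∑ τ ∈ Finset.Icc 1 t, n τ) atTop atTop) (C : ℝ) {ε : ℝ}
    (hε : 0 < ε) :
    ∀ᶠ t in atTop, ∀ c : S → ℝ, (∀ s, |c s| ≤ C) →
      dirichletBias ρ α (posterior φ₀ n x t s a) c (sampleSize N₀ n x s a t) ≤ ε := by
  have hpost : ∀ t s', 1 ≤ posterior φ₀ n x t s a s' := fun t s' =>
    (hφ₀ s a s').trans (le_posterior t s')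
  -- Either visits diverge and the posterior concentrates, with any positive sample size sufficing,
  -- or they converge in `ℕ`, hence are eventually constant, and the sample size diverges for a
  -- frozen posterior.
  rcases tendsto_atTop_of_monotone (monotone_visits (n := n) (x := x) (s := s) (a := a)) with h | ⟨l, hl⟩
  · have hsum : Tendsto (fun t => ∑ s', posterior φ₀ n x t s a s') atTop atTop := by
      simp only [sum_posterior]
      exact tendsto_atTop_add_const_left _ _ (tendsto_natCast_atTop_atTop.comp h)
    have hlim : Tendsto (fun t => α⁻¹ * (3 * (min α (1 - α))⁻¹ + 1) *
        (Fintype.card S * C * (√(∑ s', posterior φ₀ n x t s a s'))⁻¹)) atTop (𝓝 0) := by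
      have := (tendsto_inv_atTop_zero.comp (Real.tendsto_sqrt_atTop.comp hsum))
      simpa [Function.comp_def] using
        (this.const_mul (Fintype.card S * C : ℝ)).const_mul (α⁻¹ * (3 * (min α (1 - α))⁻¹ + 1))
    filter_upwards [hlim.eventually (gt_mem_nhds hε)] with t ht c hc
    exact (dirichletBias_le_of_sum ρ hα0 hα1 (hpost t) hc (hN₀.trans (le_sampleSize t))).trans ht.le
  · have hev : ∀ᶠ t in atTop, visits n x s a t = l := by
      simpa using hl
    obtain ⟨T, hT⟩ := eventually_atTop.1 hev
    have hbound : ∀ t, visits n x s a t ≤ l := fun t =>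
      (monotone_visits (le_max_left t T)).trans (hT _ (le_max_right t T)).le
    have hN := tendsto_sampleSize (N₀ := N₀) hn hbound
    filter_upwards [hN.eventually (eventually_dirichletBias_le ρ hα0 hα1 (hpost T) C hε),
      eventually_ge_atTop T] with t ht htT c hc
    rw [posterior_eq_of_visits_eq htT ((hT t htT).trans (hT T le_rfl).symm)]
    exact ht c hc

end Path

/-- The stage of an iteration tends to infinity with the iteration. -/
theorem tendsto_stageOf {m : ℕ → ℕ}
    (hm : Tendsto (fun t => ∑ τ ∈ Finset.Icc 1 t, m τ) atTop atTop) :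
    Tendsto (stageOf m) atTop atTop := by
  refine tendsto_atTop.2 fun T => ?_
  filter_upwards [eventually_gt_atTop (∑ τ ∈ Finset.Icc 1 T, m τ)] with k hk
  by_contra hlt
  have := (stageOf_spec m hm k (by omega)).2.2
  have := Finset.sum_le_sum_of_subset (f := m)
    (Finset.Icc_subset_Icc_right (a := 1) (not_le.1 hlt).le)
  omega

/-! ### Dependence of posterior and sample size on the past only -/

section Observations

variable {S A : Type*} [DecidableEq S] [DecidableEq A]

theorem posterior_congr {φ₀ : S → A → S → ℝ} {n : ℕ → ℕ} {x y : ℕ → ℕ → S × A × S} {t : ℕ}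
    (h : ∀ τ ∈ Finset.Icc 1 t, ∀ i ∈ Finset.range (n τ), x τ i = y τ i) :
    posterior φ₀ n x t = posterior φ₀ n y t := by
  ext s a s'
  simp only [posterior]
  congr 1
  refine Finset.sum_congr rfl fun τ hτ => ?_
  rw [Finset.filter_congr fun i hi => by rw [h τ hτ i hi]]

theorem batchSampleSize_congr {N₀ : ℕ} {s : S} {a : A} {b b' : ℕ → S × A × S} {M N : ℕ}
    (h : ∀ i < N, b i = b' i) : batchSampleSize N₀ s a b M N = batchSampleSize N₀ s a b' M N := by
  induction N with
  | zero => rfl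
  | succ N ih =>
    rw [batchSampleSize, batchSampleSize, h N (Nat.lt_succ_self N),
      ih fun i hi => h i (Nat.lt_succ_of_lt hi)]

theorem sampleSize_congr {N₀ : ℕ} {n : ℕ → ℕ} {x y : ℕ → ℕ → S × A × S} {s : S} {a : A} {t : ℕ}
    (h : ∀ τ ∈ Finset.Icc 1 t, ∀ i ∈ Finset.range (n τ), x τ i = y τ i) :
    sampleSize N₀ n x s a t = sampleSize N₀ n y s a t := by
  induction t with
  | zero => rfl
  | succ t ih =>
    rw [sampleSize, sampleSize, ih fun τ hτ => h τ
      (Finset.Icc_subset_Icc_right (Nat.le_succ t) hτ)]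
    exact batchSampleSize_congr fun i hi =>
      h (t + 1) (Finset.mem_Icc.2 ⟨by omega, le_rfl⟩) i (Finset.mem_range.2 hi)

end Observations

/-! ### Conditional expectations given the past observations -/

section PastEvent

set_option linter.unusedSectionVars false

variable {Ω S A : Type*} [MeasurableSpace Ω] {n : ℕ → ℕ} {obs : ℕ → ℕ → Ω → S × A × S} {t : ℕ}

theorem mem_pastEvent_self (ω : Ω) : ω ∈ pastEvent n obs (fun τ i => obs τ i ω) t :=
  fun _ _ _ _ => rfl

/-- Batch sizes are deterministic and `S`, `A` finite, so past events are fibres of a map `G` into a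
finite type. -/
theorem finite_range_pastEvent [Finite S] [Finite A] :
    (Set.range fun ω => pastEvent n obs (fun τ i => obs τ i ω) t).Finite := by
  let G : Ω → (τ : Finset.Icc 1 t) → Finset.range (n τ) → S × A × S := fun ω τ i => obs τ i ω
  refine (Set.finite_range fun g => G ⁻¹' {g}).subset ?_
  rintro _ ⟨ω, rfl⟩
  refine ⟨G ω, ?_⟩
  ext ω'
  simp only [Set.mem_preimage, Set.mem_singleton_iff]
  constructor
  · intro h τ hτ i hi
    exact congrFun (congrFun h ⟨τ, hτ⟩) ⟨i, hi⟩
  · intro h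
    ext1 τ
    ext1 i
    exact h τ τ.2 i i.2

theorem sUnion_range_pastEvent :
    ⋃₀ (Set.range fun ω => pastEvent n obs (fun τ i => obs τ i ω) t) = Set.univ :=
  Set.eq_univ_of_forall fun ω => ⟨_, ⟨ω, rfl⟩, mem_pastEvent_self ω⟩

/-- Past events form a finite cover. On each of them the random sample size is constant, so
measurability and integrability of the estimator can be checked there. -/
theorem integrable_of_integrableOn_pastEvent [Finite S] [Finite A] {P : Measure Ω} {f : Ω → ℝ}
    (h : ∀ x, IntegrableOn f (pastEvent n obs x t) P) : Integrable f P := by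
  rw [← integrableOn_univ, ← sUnion_range_pastEvent (n := n) (obs := obs) (t := t),
    Set.sUnion_eq_biUnion, integrableOn_finite_biUnion finite_range_pastEvent]
  rintro _ ⟨ω, rfl⟩
  exact h _

theorem ae_measure_pastEvent_ne_zero [Finite S] [Finite A] (P : Measure Ω) :
    ∀ᵐ ω ∂P, P (pastEvent n obs (fun τ i => obs τ i ω) t) ≠ 0 := by
  rw [ae_iff]
  set F := (Set.range fun ω => pastEvent n obs (fun τ i => obs τ i ω) t) ∩ {B | P B = 0}
  have hF : F.Finite := finite_range_pastEvent.inter_of_left _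
  refine measure_mono_null (t := ⋃₀ F) (fun ω hω => ?_)
    ((measure_sUnion_null_iff hF.countable).2 fun B hB => hB.2)
  exact ⟨_, ⟨⟨ω, rfl⟩, by simpa using hω⟩, mem_pastEvent_self ω⟩

variable [MeasurableSpace S] [MeasurableSpace A]

theorem pastObservations_le (hobs : ∀ t i, Measurable (obs t i)) :
    pastObservations n obs t ≤ ‹MeasurableSpace Ω› :=
  iSup₂_le fun τ _ => iSup₂_le fun i _ => (hobs τ i).comap_le

theorem measurableSet_pastObservations_pastEvent [MeasurableSingletonClass S]
    [MeasurableSingletonClass A] (x : ℕ → ℕ → S × A × S) :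
    MeasurableSet[pastObservations n obs t] (pastEvent n obs x t) := by
  have : pastEvent n obs x t =
      ⋂ τ ∈ Finset.Icc 1 t, ⋂ i ∈ Finset.range (n τ), obs τ i ⁻¹' {x τ i} := by
    ext ω
    simp only [pastEvent, Set.mem_iInter]
    rfl
  rw [this]
  refine Finset.measurableSet_biInter _ fun τ hτ => Finset.measurableSet_biInter _ fun i hi => ?_
  have hle : MeasurableSpace.comap (obs τ i) inferInstance ≤ pastObservations n obs t :=
    le_iSup₂_of_le τ hτ (le_iSup₂_of_le i hi le_rfl)
  exact hle _ ⟨{x τ i}, measurableSet_singleton _, rfl⟩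

/-- A function of the past observations is constant on the events they generate. -/
theorem eq_of_mem_pastEvent {f : Ω → ℝ} (hf : Measurable[pastObservations n obs t] f)
    {x : ℕ → ℕ → S × A × S} {ω ω' : Ω} (hω : ω ∈ pastEvent n obs x t)
    (hω' : ω' ∈ pastEvent n obs x t) : f ω = f ω' := by
  -- Every generating observation is constant along the two-point map `g`, so each set of the past
  -- σ-algebra pulls back to `∅` or everything: it contains both points or neither.
  let g : Bool → Ω := fun b => cond b ω ω'
  have hle : pastObservations n obs t ≤ MeasurableSpace.map g ⊥ := by
    refine iSup₂_le fun τ hτ => iSup₂_le fun i hi => ?_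
    rintro _ ⟨T, -, rfl⟩
    have hconst : obs τ i ∘ g = fun _ => x τ i := by
      funext b
      cases b
      · exact hω' τ hτ i hi
      · exact hω τ hτ i hi
    change MeasurableSet[⊥] (g ⁻¹' (obs τ i ⁻¹' T))
    rw [← Set.preimage_comp, hconst, MeasurableSpace.measurableSet_bot_iff]
    by_cases hx : x τ i ∈ T <;> simp [Set.preimage, hx]
  have h := hle _ (hf (measurableSet_singleton (f ω)))
  have h' : MeasurableSet[⊥] (g ⁻¹' (f ⁻¹' {f ω})) := h
  have htrue : true ∈ g ⁻¹' (f ⁻¹' {f ω}) := rfl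
  rcases MeasurableSpace.measurableSet_bot_iff.1 h' with h0 | h1
  · rw [h0] at htrue
    exact htrue.elim
  · have hfalse : false ∈ g ⁻¹' (f ⁻¹' {f ω}) := by
      rw [h1]
      trivial
    exact (show f ω' = f ω from hfalse).symm

/-- The conditional expectation is measurable for the past, hence constant on a past event, and its
integral there is prescribed. The identity thus holds at every point `ω` of the event, not just
almost everywhere. -/
theorem measureReal_mul_condExp_eq_setIntegral [MeasurableSingletonClass S]
    [MeasurableSingletonClass A] {P : Measure Ω} [IsProbabilityMeasure P]
    (hobs : ∀ t i, Measurable (obs t i)) {f : Ω → ℝ} (hf : Integrable f P)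
    {x : ℕ → ℕ → S × A × S} {ω : Ω} (hω : ω ∈ pastEvent n obs x t) :
    P.real (pastEvent n obs x t) * (P[f | pastObservations n obs t]) ω =
      ∫ ω' in pastEvent n obs x t, f ω' ∂P := by
  have hle := pastObservations_le (n := n) (t := t) hobs
  have hms := measurableSet_pastObservations_pastEvent (n := n) (obs := obs) (t := t) x
  rw [← setIntegral_condExp hle hf hms,
    setIntegral_congr_fun (g := fun _ => (P[f | pastObservations n obs t]) ω) (hle _ hms)
      fun ω' hω' => eq_of_mem_pastEvent (stronglyMeasurable_condExp.measurable) hω' hω]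
  simp

end PastEvent

/-! ### The conditional bias as a Dirichlet bias -/

section Sampling

set_option linter.unusedSectionVars false

variable {Ω S A : Type*} [MeasurableSpace Ω] [Fintype S] [DecidableEq S] [Nonempty S]
  [MeasurableSpace S] [MeasurableSingletonClass S] [Fintype A] [DecidableEq A]
  [MeasurableSpace A] [MeasurableSingletonClass A]
  {P : Measure Ω} [IsProbabilityMeasure P] {r : S → A → S → ℝ} {γ : ℝ} {ρ : RiskKind} {α : ℝ}
  {φ₀ : S → A → S → ℝ} {N₀ : ℕ} {n m : ℕ → ℕ} {obs : ℕ → ℕ → Ω → S × A × S}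
  {p : ℕ → S → A → ℕ → Ω → S → ℝ}

/-- The linear functional whose mean under `p` is `f(p | s, a, Q)`. -/
noncomputable def stateValues (r : S → A → S → ℝ) (γ : ℝ) (Q : S → A → ℝ) (s : S) (a : A) (s' : S) : ℝ :=
  r s a s' + γ * ⨆ b, Q s' b

theorem abs_le_rewardBound (s : S) (a : A) (s' : S) : |r s a s'| ≤ rewardBound r :=
  le_ciSup (f := fun x : S × A × S => |r x.1 x.2.1 x.2.2|) (Set.finite_range _).bddAbove (s, a, s')

theorem abs_stateValues_le [Nonempty A] (hγ0 : 0 ≤ γ) {Q : S → A → ℝ} {K : ℝ} (hQ : ‖Q‖ ≤ K)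
    (s : S) (a : A) (s' : S) : |stateValues r γ Q s a s'| ≤ rewardBound r + γ * K := by
  have hb : ∀ b, |Q s' b| ≤ K := fun b =>
    ((norm_le_pi_norm (Q s') b).trans (norm_le_pi_norm Q s')).trans hQ
  have hsup : |⨆ b, Q s' b| ≤ K := by
    rw [abs_le]
    exact ⟨le_ciSup_of_le (Set.finite_range _).bddAbove (Classical.arbitrary A)
      (abs_le.1 (hb _)).1, ciSup_le fun b => (abs_le.1 (hb b)).2⟩
  refine (abs_add_le _ _).trans (add_le_add (abs_le_rewardBound s a s') ?_)
  rw [abs_mul, abs_of_nonneg hγ0]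
  exact mul_le_mul_of_nonneg_left hsup hγ0

theorem measurable_samples (hp : ∀ k s a i, Measurable (p k s a i)) (k : ℕ) (s : S) (a : A)
    (N : ℕ) : Measurable fun ω (i : Fin N) => p k s a i ω :=
  measurable_pi_lambda _ fun i => hp k s a i

/-- On a past event, the samples of iteration `k` are distributed as an independent sample from
the posterior. -/
theorem map_restrict_pastEvent (hp : ∀ k s a i, Measurable (p k s a i))
    (hsample : SampledFromPosterior P φ₀ N₀ n m obs p) {k : ℕ} (hk : 1 ≤ k) (s : S) (a : A)
    (x : ℕ → ℕ → S × A × S) :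
    (P.restrict (pastEvent n obs x (stageOf m k))).map
        (fun ω (i : Fin (sampleSize N₀ n x s a (stageOf m k))) => p k s a i ω) =
      P (pastEvent n obs x (stageOf m k)) •
        Measure.pi fun _ => dirichlet (posterior φ₀ n x (stageOf m k) s a) := by
  have hmeas := measurable_samples hp k s a (sampleSize N₀ n x s a (stageOf m k))
  ext B hB
  rw [Measure.map_apply hmeas hB, Measure.restrict_apply (hmeas hB), Set.inter_comm,
    Measure.smul_apply, smul_eq_mul]
  exact hsample k hk s a x B hB

theorem iterEstimator_eq_on_pastEvent (x : ℕ → ℕ → S × A × S) (k : ℕ) (Q : S → A → ℝ) (s : S)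
    (a : A) {ω : Ω} (hω : ω ∈ pastEvent n obs x (stageOf m k)) :
    iterEstimator ρ α r γ N₀ n m obs p k Q s a ω =
      riskEstimator ρ α fun i : Fin (sampleSize N₀ n x s a (stageOf m k)) =>
        weightedMean (stateValues r γ Q s a) (p k s a i ω) := by
  have h : sampleSize N₀ n (fun τ i => obs τ i ω) s a (stageOf m k) =
      sampleSize N₀ n x s a (stageOf m k) := sampleSize_congr hω
  -- The sample size occurs in the type `Fin N`; abstracting it as an argument allows rewriting with
  -- `h`.
  change (fun N : ℕ => riskEstimator ρ α fun i : Fin N =>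
    weightedMean (stateValues r γ Q s a) (p k s a i ω)) _ = _
  rw [h]

theorem iterBellman_eq_on_pastEvent (x : ℕ → ℕ → S × A × S) (k : ℕ) (Q : S → A → ℝ) (s : S)
    (a : A) {ω : Ω} (hω : ω ∈ pastEvent n obs x (stageOf m k)) :
    iterBellman ρ α r γ φ₀ n m obs k Q s a ω =
      risk ρ α (dirichlet (posterior φ₀ n x (stageOf m k) s a))
        (weightedMean (stateValues r γ Q s a)) := by
  rw [iterBellman, posterior_congr (x := fun t i => obs t i ω) (y := x) hω]
  rfl

theorem measurableSet_pastEvent (hobs : ∀ t i, Measurable (obs t i)) (x : ℕ → ℕ → S × A × S)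
    (t : ℕ) : MeasurableSet (pastEvent n obs x t) :=
  pastObservations_le hobs _ (measurableSet_pastObservations_pastEvent x)

theorem integrableOn_iterBellman (hobs : ∀ t i, Measurable (obs t i)) (k : ℕ) (Q : S → A → ℝ)
    (s : S) (a : A) (x : ℕ → ℕ → S × A × S) :
    IntegrableOn (iterBellman ρ α r γ φ₀ n m obs k Q s a) (pastEvent n obs x (stageOf m k)) P :=
  (integrableOn_const (C := risk ρ α (dirichlet (posterior φ₀ n x (stageOf m k) s a))
    (weightedMean (stateValues r γ Q s a)))).congr_fun
    (fun _ hω => (iterBellman_eq_on_pastEvent x k Q s a hω).symm)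
    (measurableSet_pastEvent hobs x _)

theorem integrableOn_iterEstimator (hφ₀ : ∀ s a s', 1 ≤ φ₀ s a s')
    (hobs : ∀ t i, Measurable (obs t i)) (hp : ∀ k s a i, Measurable (p k s a i))
    (hsample : SampledFromPosterior P φ₀ N₀ n m obs p) {k : ℕ} (hk : 1 ≤ k) (Q : S → A → ℝ)
    (s : S) (a : A) (x : ℕ → ℕ → S × A × S) :
    IntegrableOn (iterEstimator ρ α r γ N₀ n m obs p k Q s a)
      (pastEvent n obs x (stageOf m k)) P := by
  have ha : ∀ s', 1 ≤ posterior φ₀ n x (stageOf m k) s a s' := fun s' =>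
    (hφ₀ s a s').trans (le_posterior _ s')
  have := isProbabilityMeasure_dirichlet ha
  set c := stateValues r γ Q s a
  have hint := (integrable_riskEstimator (α := α)
    (N := sampleSize N₀ n x s a (stageOf m k)) (measurable_weightedMean c)
    (integrable_weightedMean ha c) ρ).smul_measure
      (measure_ne_top P (pastEvent n obs x (stageOf m k)))
  rw [← map_restrict_pastEvent hp hsample hk s a x, integrable_map_measure
    (measurable_riskEstimator_weightedMean ρ α c _).aestronglyMeasurable
    (measurable_samples hp k s a _).aemeasurable] at hint
  exact IntegrableOn.congr_fun hint
    (fun _ hω => (iterEstimator_eq_on_pastEvent x k Q s a hω).symm)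
    (measurableSet_pastEvent hobs x _)

theorem setIntegral_iterEstimator
    (hobs : ∀ t i, Measurable (obs t i)) (hp : ∀ k s a i, Measurable (p k s a i))
    (hsample : SampledFromPosterior P φ₀ N₀ n m obs p) {k : ℕ} (hk : 1 ≤ k) (Q : S → A → ℝ)
    (s : S) (a : A) (x : ℕ → ℕ → S × A × S) :
    ∫ ω in pastEvent n obs x (stageOf m k), iterEstimator ρ α r γ N₀ n m obs p k Q s a ω ∂P =
      P.real (pastEvent n obs x (stageOf m k)) *
        ∫ q, riskEstimator ρ α (fun i : Fin (sampleSize N₀ n x s a (stageOf m k)) =>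
          weightedMean (stateValues r γ Q s a) (q i))
          ∂(Measure.pi fun _ => dirichlet (posterior φ₀ n x (stageOf m k) s a)) := by
  rw [setIntegral_congr_fun (measurableSet_pastEvent hobs x _)
    (fun _ hω => iterEstimator_eq_on_pastEvent x k Q s a hω), measureReal_def, ← smul_eq_mul,
    ← integral_smul_measure, ← map_restrict_pastEvent hp hsample hk s a x, integral_map
    (measurable_samples hp k s a _).aemeasurable
    (measurable_riskEstimator_weightedMean ρ α _ _).aestronglyMeasurable]

theorem integrable_iterEstimator (hφ₀ : ∀ s a s', 1 ≤ φ₀ s a s')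
    (hobs : ∀ t i, Measurable (obs t i)) (hp : ∀ k s a i, Measurable (p k s a i))
    (hsample : SampledFromPosterior P φ₀ N₀ n m obs p) {k : ℕ} (hk : 1 ≤ k) (Q : S → A → ℝ)
    (s : S) (a : A) : Integrable (iterEstimator ρ α r γ N₀ n m obs p k Q s a) P :=
  integrable_of_integrableOn_pastEvent fun x =>
    integrableOn_iterEstimator hφ₀ hobs hp hsample hk Q s a x

theorem integrable_iterBellman (hobs : ∀ t i, Measurable (obs t i)) (k : ℕ) (Q : S → A → ℝ)
    (s : S) (a : A) : Integrable (iterBellman ρ α r γ φ₀ n m obs k Q s a) P :=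
  integrable_of_integrableOn_pastEvent fun x => integrableOn_iterBellman hobs k Q s a x

/-- On past events of positive probability, the conditional bias of the Bellman estimator is the
bias of the estimator from a Dirichlet sample. -/
theorem abs_condExp_iterEstimator_sub_iterBellman (hφ₀ : ∀ s a s', 1 ≤ φ₀ s a s')
    (hobs : ∀ t i, Measurable (obs t i)) (hp : ∀ k s a i, Measurable (p k s a i))
    (hsample : SampledFromPosterior P φ₀ N₀ n m obs p) {k : ℕ} (hk : 1 ≤ k) (Q : S → A → ℝ)
    (s : S) (a : A) {x : ℕ → ℕ → S × A × S} {ω : Ω}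
    (hω : ω ∈ pastEvent n obs x (stageOf m k)) (hP : P (pastEvent n obs x (stageOf m k)) ≠ 0) :
    |(P[fun ω' => iterEstimator ρ α r γ N₀ n m obs p k Q s a ω' -
        iterBellman ρ α r γ φ₀ n m obs k Q s a ω' | pastObservations n obs (stageOf m k)]) ω| =
      dirichletBias ρ α (posterior φ₀ n x (stageOf m k) s a) (stateValues r γ Q s a)
        (sampleSize N₀ n x s a (stageOf m k)) := by
  have hE := integrable_iterEstimator (ρ := ρ) (α := α) (r := r) (γ := γ) hφ₀ hobs hp hsample hk
    Q s a
  have hB := integrable_iterBellman (P := P) (ρ := ρ) (α := α) (r := r) (γ := γ) (φ₀ := φ₀)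
    (n := n) (m := m) hobs k Q s a
  have h := measureReal_mul_condExp_eq_setIntegral hobs (hE.sub hB) hω
  have hBell : ∫ ω' in pastEvent n obs x (stageOf m k), iterBellman ρ α r γ φ₀ n m obs k Q s a ω'
      ∂P = P.real (pastEvent n obs x (stageOf m k)) *
        risk ρ α (dirichlet (posterior φ₀ n x (stageOf m k) s a))
          (weightedMean (stateValues r γ Q s a)) := by
    rw [setIntegral_congr_fun (measurableSet_pastEvent hobs x _)
      (fun _ hω => iterBellman_eq_on_pastEvent x k Q s a hω)]
    simp
  simp only [Pi.sub_apply] at h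
  rw [integral_sub hE.integrableOn hB.integrableOn, hBell,
    setIntegral_iterEstimator hobs hp hsample hk, ← mul_sub] at h
  have h' := mul_left_cancel₀ (show P.real (pastEvent n obs x (stageOf m k)) ≠ 0 from
    ENNReal.toReal_ne_zero.2 ⟨hP, measure_ne_top _ _⟩) h
  rw [dirichletBias, ← h']
  rfl

end Sampling

end BRQL

theorem mainTheorem2 {Ω S A : Type*} [MeasurableSpace Ω]
    [Fintype S] [DecidableEq S] [Nonempty S] [MeasurableSpace S] [MeasurableSingletonClass S]
    [Fintype A] [DecidableEq A] [Nonempty A] [MeasurableSpace A] [MeasurableSingletonClass A]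
    (P : Measure Ω) [IsProbabilityMeasure P]
    (r : S → A → S → ℝ) (γ : ℝ) (hγ0 : 0 ≤ γ) (hγ1 : γ < 1)
    (ρ : BRQL.RiskKind) (α : ℝ) (hα0 : 0 < α) (hα1 : α < 1)
    (φ₀ : S → A → S → ℝ) (hφ₀ : ∀ s a s', 1 ≤ φ₀ s a s')
    (N₀ : ℕ) (hN₀ : 1 ≤ N₀)
    (n m : ℕ → ℕ)
    (hn : Tendsto (fun t => ∑ τ ∈ Finset.Icc 1 t, n τ) atTop atTop)
    (hm : Tendsto (fun t => ∑ τ ∈ Finset.Icc 1 t, m τ) atTop atTop)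
    (obs : ℕ → ℕ → Ω → S × A × S) (hobs : ∀ t i, Measurable (obs t i))
    (p : ℕ → S → A → ℕ → Ω → S → ℝ) (hp : ∀ k s a i, Measurable (p k s a i))
    (hsample : BRQL.SampledFromPosterior P φ₀ N₀ n m obs p) :
    (∀ k, 1 ≤ k → ∀ (Q : S → A → ℝ) (s : S) (a : A),
      Integrable (BRQL.iterEstimator ρ α r γ N₀ n m obs p k Q s a) P ∧
      Integrable (BRQL.iterBellman ρ α r γ φ₀ n m obs k Q s a) P) ∧
    ∀ (s : S) (a : A), ∀ᵐ ω ∂P,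
      Tendsto (fun k => ⨆ Q ∈ {Q : S → A → ℝ | ‖Q‖ ≤ BRQL.rewardBound r / (1 - γ)},
        ENNReal.ofReal |(P[fun ω' => BRQL.iterEstimator ρ α r γ N₀ n m obs p k Q s a ω' -
          BRQL.iterBellman ρ α r γ φ₀ n m obs k Q s a ω'
            | BRQL.pastObservations n obs (BRQL.stageOf m k)]) ω|)
        atTop (𝓝 0) := by
  refine ⟨fun k hk Q s a => ⟨BRQL.integrable_iterEstimator hφ₀ hobs hp hsample hk Q s a,
    BRQL.integrable_iterBellman hobs k Q s a⟩, fun s a => ?_⟩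
  -- The only exceptional set: countably many iterations, each with finitely many null past events,
  -- and independent of `Q`.
  have hpos : ∀ᵐ ω ∂P, ∀ k,
      P (BRQL.pastEvent n obs (fun t i => obs t i ω) (BRQL.stageOf m k)) ≠ 0 :=
    ae_all_iff.2 fun k => BRQL.ae_measure_pastEvent_ne_zero P
  filter_upwards [hpos] with ω hω
  rw [ENNReal.tendsto_nhds_zero]
  intro ε hε
  obtain ⟨δ, hδ0, hδε⟩ := ENNReal.lt_iff_exists_nnreal_btwn.1 hε
  have hδ : (0 : ℝ) < δ := by exact_mod_cast hδ0
  filter_upwards [(BRQL.tendsto_stageOf hm).eventually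
    (BRQL.eventually_dirichletBias_posterior_le (x := fun t i => obs t i ω) (s := s) (a := a) ρ
      hα0 hα1 hφ₀ hN₀ hn
      -- The bound on `stateValues` valid for every `Q` in the ball.
      (BRQL.rewardBound r + γ * (BRQL.rewardBound r / (1 - γ))) hδ),
    eventually_ge_atTop 1] with k hk hk1
  refine iSup₂_le fun Q hQ => ?_
  rw [BRQL.abs_condExp_iterEstimator_sub_iterBellman hφ₀ hobs hp hsample hk1 Q s a
    (BRQL.mem_pastEvent_self ω) (hω k)]
  refine (ENNReal.ofReal_le_ofReal (hk _ fun s' => BRQL.abs_stateValues_le hγ0 hQ s a s')).trans ?_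
  rw [ENNReal.ofReal_coe_nnreal]
  exact hδε.le
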